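/- Let $1\le k<n$ and let $\mathcal D$ be a probability distribution on the unit sphere of $\mathbb R^n$, with covariance matrix $\Sigma=\mathbb E_{\mathbf x\sim\mathcal D}[\mathbf x\mathbf x^\top]$ and eigenvalues $\lambda_1\ge\lambda_2\ge\dots\ge\lambda_n\ge 0$ of $\Sigma$ (with multiplicity). Put $\lambda=\lambda_1+\dots+\lambda_k$ and $\mathsf{gap}=\lambda_k-\lambda_{k+1}$, and assume $\mathsf{gap}>0$. Let $0<\delta\le 1/e$. Then there is a deterministic sequence of learning rates $\eta_t>0$, $t\ge1$ (depending on $\mathcal D$, $k$ and $\delta$ only), such that the following holds. Let $V\in\mathbb R^{n\times k}$ and $Z\in\mathbb R^{n\times(n-k)}$ be matrices whose columns form orthonormal bases of the sum of the eigenspaces of $\Sigma$ for $\lambda_1,\dots,\lambda_k$ and for $\lambda_{k+1},\dots,\lambda_n$, respectively. For $W\in\mathbb R^{n\times k}$ let $X(W)=\|Z^\top W(V^\top W)^{-1}\|_F^2$ if $V^\top W$ is invertible and $X(W)=\infty$ otherwise. Let $W_0\in\mathbb R^{n\times k}$ be a matrix with $X(W_0)\le1$, let $\mathbf x_1,\mathbf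 x_2,\dots$ be i.i.d. samples from $\mathcal D$, and let $W_t=(I+\eta_t\mathbf x_t\mathbf x_t^\top)W_{t-1}$ for $t\ge1$ (Oja's algorithm). Then the process $X_t=X(W_t)$ satisfies, with natural logarithms, 1. (last iterate convergence) for every integer $T\ge1$, $$\Pr\left[X_T>\frac{2000\,\lambda\log(1/\delta)}{\mathsf{gap}^2\,T}\right]<\delta;$$ 2. (strong uniform convergence) $$\Pr\left[\exists\,t\ge1:\ X_t>\frac{30000\,\lambda\,\bigl(\log(1/\delta)+2\log\log(t+1)\bigr)}{\mathsf{gap}^2\,t}\right]<\delta.$$ -/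

import Mathlib

open MeasureTheory ProbabilityTheory

namespace StreamingPCA

noncomputable section

/-- The (uncentered) covariance matrix `Σ = E_{x ∼ D}[x xᵀ]`. -/
def covariance {n : ℕ} (D : Measure (EuclideanSpace ℝ (Fin n))) : Matrix (Fin n) (Fin n) ℝ :=
  Matrix.of fun i j => ∫ x, x i * x j ∂D

theorem covariance_isHermitian {n : ℕ} (D : Measure (EuclideanSpace ℝ (Fin n))) :
    (covariance D).IsHermitian := by
  ext i j
  simp [covariance, mul_comm]

/-- The eigenvalues of the covariance matrix, with multiplicity and in decreasing order:
`eigenvalue D i` is `λ_{i+1}`, for `i = 0, …, n - 1`. -/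
def eigenvalue {n : ℕ} (D : Measure (EuclideanSpace ℝ (Fin n))) (i : Fin n) : ℝ :=
  (covariance_isHermitian D).eigenvalues₀ (i.cast (Fintype.card_fin n).symm)

/-- `λ = λ_1 + ⋯ + λ_k`. -/
def topSum {n : ℕ} (D : Measure (EuclideanSpace ℝ (Fin n))) (k : ℕ) : ℝ :=
  ∑ i : Fin n with i.val < k, eigenvalue D i

/-- `gap = λ_k - λ_{k+1}`, for `1 ≤ k < n`. -/
def gap {n : ℕ} (D : Measure (EuclideanSpace ℝ (Fin n))) (k : ℕ) (hkn : k < n) : ℝ :=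
  eigenvalue D ⟨k - 1, by omega⟩ - eigenvalue D ⟨k, hkn⟩

/-- The sum of the eigenspaces of the covariance matrix for the eigenvalues `λ_1, …, λ_k`. -/
def topEigenspace {n : ℕ} (D : Measure (EuclideanSpace ℝ (Fin n))) (k : ℕ) :
    Submodule ℝ (Fin n → ℝ) :=
  ⨆ i : Fin n, ⨆ _ : i.val < k,
    Module.End.eigenspace (Matrix.toLin' (covariance D)) (eigenvalue D i)

/-- The sum of the eigenspaces of the covariance matrix for `λ_{k+1}, …, λ_n`. -/
def bottomEigenspace {n : ℕ} (D : Measure (EuclideanSpace ℝ (Fin n))) (k : ℕ) :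
    Submodule ℝ (Fin n → ℝ) :=
  ⨆ i : Fin n, ⨆ _ : k ≤ i.val,
    Module.End.eigenspace (Matrix.toLin' (covariance D)) (eigenvalue D i)

/-- The columns of `A` form an orthonormal basis of the subspace `S`. -/
structure IsOrthonormalBasisMatrix {n m : ℕ} (A : Matrix (Fin n) (Fin m) ℝ)
    (S : Submodule ℝ (Fin n → ℝ)) : Prop where
  orthonormal : A.transpose * A = 1
  span_eq : Submodule.span ℝ (Set.range A.transpose) = S

/-- Oja's algorithm: `W_{t+1} = (1 + η_{t+1} x_{t+1} x_{t+1}ᵀ) W_t`. The learning rate and the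
sample of step `t + 1` are `η t` and `x t`. -/
def oja {n k : ℕ} (η : ℕ → ℝ) (x : ℕ → EuclideanSpace ℝ (Fin n))
    (W₀ : Matrix (Fin n) (Fin k) ℝ) : ℕ → Matrix (Fin n) (Fin k) ℝ
  | 0 => W₀
  | t + 1 => (1 + η t • Matrix.vecMulVec (x t).ofLp (x t).ofLp) * oja η x W₀ t

open scoped Matrix.Norms.Frobenius in
/-- The potential `‖Zᵀ W (Vᵀ W)⁻¹‖_F²`, meaningful when `Vᵀ W` is invertible. -/
def potential {n k m : ℕ} (V : Matrix (Fin n) (Fin k) ℝ) (Z : Matrix (Fin n) (Fin m) ℝ)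
    (W : Matrix (Fin n) (Fin k) ℝ) : ℝ :=
  ‖Z.transpose * W * (V.transpose * W)⁻¹‖ ^ 2

/-- The potential at `W` is at most `r`; if `Vᵀ W` is singular, the potential counts as infinite. -/
def PotentialLE {n k m : ℕ} (V : Matrix (Fin n) (Fin k) ℝ) (Z : Matrix (Fin n) (Fin m) ℝ)
    (W : Matrix (Fin n) (Fin k) ℝ) (r : ℝ) : Prop :=
  IsUnit (V.transpose * W) ∧ potential V Z W ≤ r

end

end StreamingPCA

namespace StreamingPCA

open Matrix

/-! Write `S = Zᵀ W (Vᵀ W)⁻¹` and `X = ‖S‖_F²`. By `oja_step` an Oja step changes `S` by a rank-one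
matrix depending only on `S` and the sample, so `S` follows a recursion with independent inputs.
While `X ≤ 2`, the increment of `X` has mean at most `-2η·gap·X` to first order; its square and its
second-order part are controlled by `C`, the squared length of the sample's component along the
current subspace, and `E[C] ≤ 3λ`. The leading part of the variance carries another factor `X`,
which is what yields the rate `1/T`. This gives the one-step exponential moment bound
`lintegral_exp_update_le`.

For suitable `θ t`, `c t` the process `exp (θ t * X + c t)` is then a supermartingale as long as `X
≤ 2`, and the maximal inequality `measure_hit_le` bounds the probability of reaching a level. It is
used with rates `2 / (gap * (t + 1 + t₀))`, `t₀ = 400 λ L / gap²`, `L = log (1/δ)`, in two ways.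
Constant `θ = 3L` shows that `X`, starting below `1`, ever exceeds `2` with probability less than
`δ/2` (`measure_exit_le`). A weight growing like `(t + t₀)²` up to a horizon `T` turns the
contraction into the decay of `X` (`measure_weighted_exceed_le`). Taking the horizon `T` itself
gives the last iterate bound; taking dyadic horizons `2^(j+1)` with failure probabilities of order
`δ/(j+1)²` gives the uniform one, whence the iterated logarithm. -/

theorem dotProduct_mulVec_eq {m k : ℕ} (A : Matrix (Fin m) (Fin k) ℝ) (p : Fin m → ℝ)
    (q : Fin k → ℝ) : p ⬝ᵥ (A *ᵥ q) = (Aᵀ *ᵥ p) ⬝ᵥ q := by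
  rw [dotProduct_mulVec, ← mulVec_transpose]

/-! ### Block splitting of the covariance matrix. -/

section Spectral

variable {n : ℕ} (D : Measure (EuclideanSpace ℝ (Fin n)))

theorem eigenvalue_antitone : Antitone (eigenvalue D) := by
  intro i j h
  exact (covariance_isHermitian D).eigenvalues₀_antitone (by simpa using h)

theorem dotProduct_covariance_comm (p q : Fin n → ℝ) :
    p ⬝ᵥ (covariance D *ᵥ q) = (covariance D *ᵥ p) ⬝ᵥ q := by
  have h : (covariance D)ᵀ = covariance D := by
    simpa using (covariance_isHermitian D).eq
  rw [dotProduct_mulVec_eq, h]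

/-- An orthonormal basis of eigenvectors of the covariance matrix, in the order of `eigenvalue`. -/
theorem exists_eigenbasis : ∃ u : Fin n → Fin n → ℝ,
    (∀ i, covariance D *ᵥ u i = eigenvalue D i • u i) ∧ (∀ i, u i ⬝ᵥ u i = 1) ∧
    ∀ p q, p ⬝ᵥ q = ∑ i, (u i ⬝ᵥ p) * (u i ⬝ᵥ q) := by
  have hH := covariance_isHermitian D
  -- `eigenvectorBasis` is indexed through an arbitrary equivalence with `Fin (card)`; `e` undoes
  -- it, so that the order is the decreasing one of `eigenvalue`.
  let e : Fin n ≃ Fin n := (finCongr (Fintype.card_fin n).symm).trans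
    (Fintype.equivOfCardEq (Fintype.card_fin _))
  refine ⟨fun i => (hH.eigenvectorBasis (e i)).ofLp, fun i => ?_, fun i => ?_, fun p q => ?_⟩
  · rw [hH.mulVec_eigenvectorBasis]
    congr 1
    simp [e, Matrix.IsHermitian.eigenvalues, eigenvalue]
  · have h := hH.eigenvectorBasis.orthonormal.1 (e i)
    have h2 : inner ℝ (hH.eigenvectorBasis (e i)) (hH.eigenvectorBasis (e i)) = (1 : ℝ) := by
      rw [real_inner_self_eq_norm_sq, h]; norm_num
    rw [EuclideanSpace.inner_eq_star_dotProduct, star_trivial] at h2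
    exact h2
  · have h := hH.eigenvectorBasis.sum_inner_mul_inner (WithLp.toLp 2 p) (WithLp.toLp 2 q)
    rw [← Equiv.sum_comp e] at h
    simp only [EuclideanSpace.inner_eq_star_dotProduct, star_trivial] at h
    rw [dotProduct_comm p q, ← h]
    exact Finset.sum_congr rfl fun i _ => by rw [dotProduct_comm q]

/-- The columns of `V` and `Z` together form an orthonormal basis that splits the symmetric matrix
`A` into blocks; the upper block is at least `μ` with trace at most `l`, the lower block at most
`ν`. -/
structure IsSplitting {k m : ℕ} (A : Matrix (Fin n) (Fin n) ℝ) (V : Matrix (Fin n) (Fin k) ℝ)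
    (Z : Matrix (Fin n) (Fin m) ℝ) (μ ν l : ℝ) : Prop where
  complete : V * Vᵀ + Z * Zᵀ = 1
  left_cross : Vᵀ * A * Z = 0
  right_cross : Zᵀ * A * V = 0
  le_left : ∀ r, μ * (r ⬝ᵥ r) ≤ (V *ᵥ r) ⬝ᵥ (A *ᵥ (V *ᵥ r))
  right_le : ∀ s, (Z *ᵥ s) ⬝ᵥ (A *ᵥ (Z *ᵥ s)) ≤ ν * (s ⬝ᵥ s)
  trace_le : (Vᵀ * A * V).trace ≤ l

variable {D}

theorem dotProduct_eq_zero_of_eigenvalue_ne {u : Fin n → ℝ} {r : ℝ}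
    (hu : covariance D *ᵥ u = r • u) {p : Fin n → Prop} (hp : ∀ i, p i → eigenvalue D i ≠ r)
    {v : Fin n → ℝ}
    (hv : v ∈ ⨆ i : Fin n, ⨆ _ : p i,
      Module.End.eigenspace (Matrix.toLin' (covariance D)) (eigenvalue D i)) :
    u ⬝ᵥ v = 0 := by
  have hle : (⨆ i : Fin n, ⨆ _ : p i,
      Module.End.eigenspace (Matrix.toLin' (covariance D)) (eigenvalue D i)) ≤
      LinearMap.ker (dotProductBilin ℝ ℝ u) := by
    refine iSup_le fun i => iSup_le fun hi w hw => ?_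
    rw [Module.End.mem_eigenspace_iff, Matrix.toLin'_apply] at hw
    have h1 := dotProduct_covariance_comm D u w
    rw [hw, hu, dotProduct_smul, smul_dotProduct, smul_eq_mul, smul_eq_mul] at h1
    have h2 : (eigenvalue D i - r) * (u ⬝ᵥ w) = 0 := by linarith
    rcases mul_eq_zero.1 h2 with h | h
    · exact absurd (sub_eq_zero.1 h) (hp i hi)
    · simpa [LinearMap.mem_ker] using h
  simpa [LinearMap.mem_ker] using hle hv

theorem IsOrthonormalBasisMatrix.mulVec_mem {m : ℕ} {A : Matrix (Fin n) (Fin m) ℝ}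
    {S : Submodule ℝ (Fin n → ℝ)} (h : IsOrthonormalBasisMatrix A S) (r : Fin m → ℝ) :
    A *ᵥ r ∈ S := by
  have hr : A *ᵥ r ∈ Submodule.span ℝ (Set.range A.col) := by
    rw [← Matrix.range_mulVecLin]
    exact ⟨r, rfl⟩
  exact h.span_eq ▸ hr

theorem IsOrthonormalBasisMatrix.mulVec_dotProduct_mulVec {m : ℕ} {A : Matrix (Fin n) (Fin m) ℝ}
    {S : Submodule ℝ (Fin n → ℝ)} (h : IsOrthonormalBasisMatrix A S) (r s : Fin m → ℝ) :
    (A *ᵥ r) ⬝ᵥ (A *ᵥ s) = r ⬝ᵥ s := by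
  rw [dotProduct_mulVec_eq, mulVec_mulVec, h.orthonormal, one_mulVec]

theorem ext_of_dotProduct_mulVec {k m : ℕ} {A : Matrix (Fin k) (Fin m) ℝ}
    (h : ∀ r s, r ⬝ᵥ (A *ᵥ s) = 0) : A = 0 := by
  ext i j
  simpa using h (Pi.single i 1) (Pi.single j 1)

theorem trace_eq_sum_dotProduct {k : ℕ} (A : Matrix (Fin n) (Fin n) ℝ)
    (V : Matrix (Fin n) (Fin k) ℝ) :
    (Vᵀ * A * V).trace = ∑ j, Vᵀ j ⬝ᵥ (A *ᵥ Vᵀ j) := by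
  simp only [trace, diag_apply, Matrix.mul_assoc]
  refine Finset.sum_congr rfl fun j _ => ?_
  simp [Matrix.mul_apply, dotProduct, mulVec]

/-- The positive gap separates the two groups of eigenvalues, so every eigenvector `u i` is
orthogonal to one of the two eigenspace sums. Everything is then read off from expansions in the
basis `u`. -/
theorem isSplitting_covariance {k : ℕ} (hk : 1 ≤ k) (hkn : k < n) (hgap : 0 < gap D k hkn)
    (hpos : ∀ i, 0 ≤ eigenvalue D i)
    {V : Matrix (Fin n) (Fin k) ℝ} {Z : Matrix (Fin n) (Fin (n - k)) ℝ}
    (hV : IsOrthonormalBasisMatrix V (topEigenspace D k))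
    (hZ : IsOrthonormalBasisMatrix Z (bottomEigenspace D k)) :
    IsSplitting (covariance D) V Z (eigenvalue D ⟨k - 1, by omega⟩) (eigenvalue D ⟨k, hkn⟩)
      (topSum D k) := by
  obtain ⟨u, hu, hu1, hsum⟩ := exists_eigenbasis D
  have hlt : ∀ i j : Fin n, i.val < k → k ≤ j.val → eigenvalue D j < eigenvalue D i := by
    intro i j hi hj
    have h1 : eigenvalue D ⟨k - 1, by omega⟩ ≤ eigenvalue D i :=
      eigenvalue_antitone D (by simp [Fin.le_def]; omega)
    have h2 : eigenvalue D j ≤ eigenvalue D ⟨k, hkn⟩ :=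
      eigenvalue_antitone D (by simpa [Fin.le_def] using hj)
    unfold gap at hgap
    linarith
  have htop : ∀ v ∈ topEigenspace D k, ∀ i : Fin n, k ≤ i.val → u i ⬝ᵥ v = 0 := fun v hv i hi =>
    dotProduct_eq_zero_of_eigenvalue_ne (hu i) (p := fun j => j.val < k)
      (fun j hj => (hlt j i hj hi).ne') hv
  have hbot : ∀ v ∈ bottomEigenspace D k, ∀ i : Fin n, i.val < k → u i ⬝ᵥ v = 0 :=
    fun v hv i hi => dotProduct_eq_zero_of_eigenvalue_ne (hu i) (p := fun j => k ≤ j.val)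
      (fun j hj => (hlt i j hi hj).ne) hv
  have hform : ∀ p q, p ⬝ᵥ (covariance D *ᵥ q) =
      ∑ i, eigenvalue D i * ((u i ⬝ᵥ p) * (u i ⬝ᵥ q)) := by
    intro p q
    rw [hsum]
    refine Finset.sum_congr rfl fun i _ => ?_
    rw [dotProduct_covariance_comm, hu, smul_dotProduct, smul_eq_mul]
    ring
  have hzero : ∀ v ∈ topEigenspace D k, ∀ z ∈ bottomEigenspace D k, ∀ i,
      (u i ⬝ᵥ v) * (u i ⬝ᵥ z) = 0 := by
    intro v hv z hz i
    rcases lt_or_ge i.val k with hi | hi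
    · rw [hbot z hz i hi, mul_zero]
    · rw [htop v hv i hi, zero_mul]
  have hVZ : Vᵀ * Z = 0 := ext_of_dotProduct_mulVec fun r s => by
    rw [← mulVec_mulVec, dotProduct_mulVec, vecMul_transpose, hsum]
    exact Finset.sum_eq_zero fun i _ => hzero _ (hV.mulVec_mem r) _ (hZ.mulVec_mem s) i
  have hZV : Zᵀ * V = 0 := by simpa using congrArg Matrix.transpose hVZ
  -- The joined matrix `[V Z]` is square up to reindexing, so its left inverse, given by
  -- orthonormality of the columns, is also a right inverse.
  have hcomplete : V * Vᵀ + Z * Zᵀ = 1 := by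
    rw [← Matrix.fromCols_mul_fromRows,
      Matrix.fromCols_mul_fromRows_eq_one_comm
        ((finCongr (by omega : n = k + (n - k))).trans finSumFinEquiv.symm),
      Matrix.fromRows_mul_fromCols, hV.orthonormal, hZ.orthonormal, hVZ, hZV,
      Matrix.fromBlocks_one]
  refine ⟨hcomplete, ?_, ?_, fun r => ?_, fun s => ?_, ?_⟩
  · refine ext_of_dotProduct_mulVec fun r s => ?_
    rw [Matrix.mul_assoc, ← mulVec_mulVec, ← mulVec_mulVec, dotProduct_mulVec, vecMul_transpose,
      hform]
    exact Finset.sum_eq_zero fun i _ => by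
      rw [hzero _ (hV.mulVec_mem r) _ (hZ.mulVec_mem s) i, mul_zero]
  · refine ext_of_dotProduct_mulVec fun r s => ?_
    rw [Matrix.mul_assoc, ← mulVec_mulVec, ← mulVec_mulVec, dotProduct_mulVec, vecMul_transpose,
      hform]
    exact Finset.sum_eq_zero fun i _ => by
      rw [mul_comm (u i ⬝ᵥ _), hzero _ (hV.mulVec_mem s) _ (hZ.mulVec_mem r) i, mul_zero]
  · rw [← hV.mulVec_dotProduct_mulVec r r, hform, hsum, Finset.mul_sum]
    refine Finset.sum_le_sum fun i _ => ?_
    rcases lt_or_ge i.val k with hi | hi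
    · exact mul_le_mul_of_nonneg_right
        (eigenvalue_antitone D (by simp [Fin.le_def]; omega)) (mul_self_nonneg _)
    · simp [htop _ (hV.mulVec_mem r) i hi]
  · rw [← hZ.mulVec_dotProduct_mulVec s s, hform, hsum, Finset.mul_sum]
    refine Finset.sum_le_sum fun i _ => ?_
    rcases lt_or_ge i.val k with hi | hi
    · simp [hbot _ (hZ.mulVec_mem s) i hi]
    · exact mul_le_mul_of_nonneg_right
        (eigenvalue_antitone D (by simpa [Fin.le_def] using hi)) (mul_self_nonneg _)
  · have hcol : ∀ j, Vᵀ j ∈ topEigenspace D k := fun j => by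
      rw [← hV.span_eq]; exact Submodule.subset_span ⟨j, rfl⟩
    -- The trace is a sum of eigenvalues weighted by these sums, which vanish for `k ≤ i`.
    have hbessel : ∀ i, ∑ j, (u i ⬝ᵥ Vᵀ j) * (u i ⬝ᵥ Vᵀ j) ≤ 1 := by
      intro i
      have h1 : u i ⬝ᵥ ((V * Vᵀ + Z * Zᵀ) *ᵥ u i) = 1 := by
        rw [hcomplete, one_mulVec, hu1]
      rw [add_mulVec, dotProduct_add, ← mulVec_mulVec, ← mulVec_mulVec, dotProduct_mulVec_eq V,
        dotProduct_mulVec_eq Z] at h1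
      have h2 : 0 ≤ (Zᵀ *ᵥ u i) ⬝ᵥ (Zᵀ *ᵥ u i) :=
        Finset.sum_nonneg fun j _ => mul_self_nonneg _
      have h3 : (Vᵀ *ᵥ u i) ⬝ᵥ (Vᵀ *ᵥ u i) = ∑ j, (u i ⬝ᵥ Vᵀ j) * (u i ⬝ᵥ Vᵀ j) :=
        Finset.sum_congr rfl fun j _ => by
          simp only [mulVec, dotProduct_comm (u i)]
      linarith
    rw [trace_eq_sum_dotProduct, topSum, Finset.sum_filter]
    simp_rw [hform]
    rw [Finset.sum_comm]
    refine Finset.sum_le_sum fun i _ => ?_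
    rw [← Finset.mul_sum]
    split_ifs with hi
    · exact mul_le_of_le_one_right (hpos i) (hbessel i)
    · refine le_of_eq (mul_eq_zero_of_right _ (Finset.sum_eq_zero fun j _ => ?_))
      rw [htop _ (hcol j) i (by omega), zero_mul]

end Spectral

/-! ### The rank-one update of `S` and its effect on the Frobenius norm. -/

section Update

variable {n k m : ℕ}

/-- The squared Frobenius norm. -/
def frobSq (S : Matrix (Fin m) (Fin k) ℝ) : ℝ := ∑ i, ∑ j, S i j ^ 2

theorem frobSq_nonneg (S : Matrix (Fin m) (Fin k) ℝ) : 0 ≤ frobSq S :=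
  Finset.sum_nonneg fun _ _ => Finset.sum_nonneg fun _ _ => sq_nonneg _

open scoped Matrix.Norms.Frobenius in
theorem potential_eq_frobSq (V : Matrix (Fin n) (Fin k) ℝ) (Z : Matrix (Fin n) (Fin m) ℝ)
    (W : Matrix (Fin n) (Fin k) ℝ) : potential V Z W = frobSq (Zᵀ * W * (Vᵀ * W)⁻¹) := by
  rw [potential, Matrix.frobenius_norm_def, ← Real.sqrt_eq_rpow, Real.sq_sqrt]
  · simp [frobSq]
  · positivity

/-- The coordinates `a + Sᵀ b` of the component of the sample along the current subspace. -/
def alongVec (S : Matrix (Fin m) (Fin k) ℝ) (a : Fin k → ℝ) (b : Fin m → ℝ) : Fin k → ℝ :=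
  a + Sᵀ *ᵥ b

/-- The coordinates `b - S a` of the component of the sample off the current subspace. -/
def offVec (S : Matrix (Fin m) (Fin k) ℝ) (a : Fin k → ℝ) (b : Fin m → ℝ) : Fin m → ℝ :=
  b - S *ᵥ a

/-- The effect of one step of Oja's algorithm on `S = Zᵀ W (Vᵀ W)⁻¹`. -/
noncomputable def update (η : ℝ) (S : Matrix (Fin m) (Fin k) ℝ) (a : Fin k → ℝ)
    (b : Fin m → ℝ) : Matrix (Fin m) (Fin k) ℝ :=
  S + (η / (1 + η * (a ⬝ᵥ alongVec S a b))) • vecMulVec (offVec S a b) (alongVec S a b)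

theorem one_add_vecMulVec_mul (a c : Fin k → ℝ) {η : ℝ} (h : 1 + η * (a ⬝ᵥ c) ≠ 0) :
    (1 + η • vecMulVec a c) * (1 - (η / (1 + η * (a ⬝ᵥ c))) • vecMulVec a c) = 1 := by
  rw [Matrix.add_mul, Matrix.mul_sub, Matrix.mul_sub, Matrix.one_mul, Matrix.mul_one,
    Matrix.one_mul, Matrix.smul_mul, Matrix.mul_smul, vecMulVec_mul_vecMulVec, vecMulVec_smul,
    dotProduct_comm c a]
  ext i j
  simp only [Matrix.add_apply, Matrix.sub_apply, Matrix.smul_apply, smul_eq_mul]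
  field_simp
  ring

/-- With `M = Vᵀ W` and `c` the along-vector, completeness gives `xᵀ W = cᵀ M`. Both blocks of the
new iterate are thus a rank-one perturbation times `M`; `M` cancels, and the Sherman–Morrison
formula `one_add_vecMulVec_mul` inverts the remaining factor. -/
theorem oja_step {V : Matrix (Fin n) (Fin k) ℝ} {Z : Matrix (Fin n) (Fin m) ℝ}
    (hVZ : V * Vᵀ + Z * Zᵀ = 1) {W : Matrix (Fin n) (Fin k) ℝ} (hW : IsUnit (Vᵀ * W))
    (x : Fin n → ℝ) (η : ℝ) {S : Matrix (Fin m) (Fin k) ℝ} (hS : S = Zᵀ * W * (Vᵀ * W)⁻¹)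
    (h : 1 + η * ((Vᵀ *ᵥ x) ⬝ᵥ alongVec S (Vᵀ *ᵥ x) (Zᵀ *ᵥ x)) ≠ 0) :
    IsUnit (Vᵀ * ((1 + η • vecMulVec x x) * W)) ∧
      update η S (Vᵀ *ᵥ x) (Zᵀ *ᵥ x) =
        Zᵀ * ((1 + η • vecMulVec x x) * W) * (Vᵀ * ((1 + η • vecMulVec x x) * W))⁻¹ := by
  set a := Vᵀ *ᵥ x with ha
  set b := Zᵀ *ᵥ x with hb
  set c := alongVec S a b with hc
  set M := Vᵀ * W with hM
  have hMM : M * M⁻¹ = 1 := Matrix.mul_nonsing_inv _ ((Matrix.isUnit_iff_isUnit_det _).1 hW)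
  have hMM' : M⁻¹ * M = 1 := Matrix.nonsing_inv_mul _ ((Matrix.isUnit_iff_isUnit_det _).1 hW)
  have hZW : Zᵀ * W = S * M := by rw [hS, Matrix.mul_assoc, hMM', Matrix.mul_one]
  have hxW : x ᵥ* W = c ᵥ* M := by
    have h1 : x = V *ᵥ a + Z *ᵥ b := by
      rw [ha, hb, mulVec_mulVec, mulVec_mulVec, ← add_mulVec, hVZ, one_mulVec]
    conv_lhs => rw [h1]
    rw [add_vecMul, ← vecMul_transpose, ← vecMul_transpose, vecMul_vecMul a, vecMul_vecMul b, hZW,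
      ← hM, ← vecMul_vecMul b S, ← add_vecMul, hc, alongVec, mulVec_transpose]
  have hVW' : Vᵀ * ((1 + η • vecMulVec x x) * W) = (1 + η • vecMulVec a c) * M := by
    rw [Matrix.add_mul, Matrix.one_mul, Matrix.mul_add, ← hM, Matrix.smul_mul, Matrix.mul_smul,
      vecMulVec_mul, hxW, mul_vecMulVec, ← ha, Matrix.add_mul, Matrix.one_mul, Matrix.smul_mul,
      vecMulVec_mul]
  have hZW' : Zᵀ * ((1 + η • vecMulVec x x) * W) = (S + η • vecMulVec b c) * M := by
    rw [Matrix.add_mul, Matrix.one_mul, Matrix.mul_add, hZW, Matrix.smul_mul, Matrix.mul_smul,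
      vecMulVec_mul, hxW, mul_vecMulVec, ← hb, Matrix.add_mul, Matrix.smul_mul,
      vecMulVec_mul]
  have hinv := one_add_vecMulVec_mul a c h
  have hr : (1 + η • vecMulVec a c) * M *
      (M⁻¹ * (1 - (η / (1 + η * (a ⬝ᵥ c))) • vecMulVec a c)) = 1 := by
    rw [Matrix.mul_assoc, ← Matrix.mul_assoc M, hMM, Matrix.one_mul, hinv]
  rw [hVW', hZW']
  refine ⟨IsUnit.of_mul_eq_one _ hr, ?_⟩
  rw [Matrix.inv_eq_right_inv hr, Matrix.mul_assoc, ← Matrix.mul_assoc M, hMM, Matrix.one_mul,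
    update, ← hc, Matrix.add_mul, Matrix.mul_sub, Matrix.mul_sub, Matrix.mul_one, Matrix.mul_one,
    Matrix.smul_mul, Matrix.mul_smul, Matrix.mul_smul, vecMulVec_mul_vecMulVec, vecMulVec_smul,
    dotProduct_comm c a, mul_vecMulVec, offVec, sub_vecMulVec]
  ext i j
  simp only [Matrix.add_apply, Matrix.sub_apply, Matrix.smul_apply, smul_eq_mul]
  field_simp
  ring

theorem frobSq_add_smul_vecMulVec (S : Matrix (Fin m) (Fin k) ℝ) (r : ℝ) (d : Fin m → ℝ)
    (c : Fin k → ℝ) : frobSq (S + r • vecMulVec d c) =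
      frobSq S + (2 * r * (d ⬝ᵥ (S *ᵥ c)) + r ^ 2 * ((d ⬝ᵥ d) * (c ⬝ᵥ c))) := by
  have h1 : d ⬝ᵥ (S *ᵥ c) = ∑ i, ∑ j, d i * (S i j * c j) := by
    simp [dotProduct, mulVec, Finset.mul_sum]
  have h2 : (d ⬝ᵥ d) * (c ⬝ᵥ c) = ∑ i, ∑ j, (d i * d i) * (c j * c j) := by
    simp [dotProduct, Finset.sum_mul_sum]
  rw [h1, h2, frobSq, frobSq, Finset.mul_sum, Finset.mul_sum, ← Finset.sum_add_distrib,
    ← Finset.sum_add_distrib]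
  refine Finset.sum_congr rfl fun i _ => ?_
  rw [Finset.mul_sum, Finset.mul_sum, ← Finset.sum_add_distrib, ← Finset.sum_add_distrib]
  refine Finset.sum_congr rfl fun j _ => ?_
  simp only [Matrix.add_apply, Matrix.smul_apply, smul_eq_mul, vecMulVec_apply]
  ring

theorem dotProduct_sq_le (p q : Fin m → ℝ) : (p ⬝ᵥ q) ^ 2 ≤ (p ⬝ᵥ p) * (q ⬝ᵥ q) := by
  simpa [dotProduct, sq] using Finset.sum_mul_sq_le_sq_mul_sq Finset.univ p q

theorem dotProduct_self_nonneg' (p : Fin m → ℝ) : 0 ≤ p ⬝ᵥ p :=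
  Finset.sum_nonneg fun _ _ => mul_self_nonneg _

theorem frobSq_transpose (S : Matrix (Fin m) (Fin k) ℝ) : frobSq Sᵀ = frobSq S :=
  Finset.sum_comm

theorem mulVec_dotProduct_self_le (S : Matrix (Fin m) (Fin k) ℝ) (c : Fin k → ℝ) :
    (S *ᵥ c) ⬝ᵥ (S *ᵥ c) ≤ frobSq S * (c ⬝ᵥ c) := by
  rw [frobSq, Finset.sum_mul]
  refine Finset.sum_le_sum fun i _ => ?_
  have h := dotProduct_sq_le (S i) c
  rw [← sq]
  simpa [dotProduct, sq, mulVec] using h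

/-- The cross terms `2 a·Sᵀb` and `-2 b·Sa` cancel. -/
theorem alongVec_add_offVec_le (S : Matrix (Fin m) (Fin k) ℝ) (a : Fin k → ℝ) (b : Fin m → ℝ)
    (hab : a ⬝ᵥ a + b ⬝ᵥ b = 1) :
    alongVec S a b ⬝ᵥ alongVec S a b + offVec S a b ⬝ᵥ offVec S a b ≤ 1 + frobSq S := by
  have h1 := mulVec_dotProduct_self_le S a
  have h2 := mulVec_dotProduct_self_le Sᵀ b
  rw [frobSq_transpose] at h2
  have h3 : b ⬝ᵥ (S *ᵥ a) = (Sᵀ *ᵥ b) ⬝ᵥ a := dotProduct_mulVec_eq S b a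
  simp only [alongVec, offVec, add_dotProduct, dotProduct_add, sub_dotProduct, dotProduct_sub]
  rw [dotProduct_comm a (Sᵀ *ᵥ b), dotProduct_comm (S *ᵥ a) b, h3]
  have h4 : frobSq S * (a ⬝ᵥ a) + frobSq S * (b ⬝ᵥ b) = frobSq S := by
    rw [← mul_add, hab, mul_one]
  linarith

theorem dotProduct_mulVec_sq_le (S : Matrix (Fin m) (Fin k) ℝ) (d : Fin m → ℝ) (c : Fin k → ℝ) :
    (d ⬝ᵥ (S *ᵥ c)) ^ 2 ≤ (d ⬝ᵥ d) * frobSq S * (c ⬝ᵥ c) := by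
  refine (dotProduct_sq_le _ _).trans ?_
  rw [mul_assoc]
  exact mul_le_mul_of_nonneg_left (mulVec_dotProduct_self_le S c) (dotProduct_self_nonneg' d)

end Update

/-! ### The exponential moment of one step. -/

section Moment

/-- The increment of the potential is linear in the learning rate up to a remainder of second
order. -/
theorem exists_increment_remainder {X C B g u η : ℝ} (hX0 : 0 ≤ X) (hX : X ≤ 2) (hC : 0 ≤ C)
    (hB : 0 ≤ B) (hCB : C + B ≤ 3) (hg : g ^ 2 ≤ B * X * C) (hu : u ^ 2 ≤ C) (hη0 : 0 < η)
    (hη : η ≤ 1 / 200) :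
    ∃ R, 2 * (η / (1 + η * u)) * g + (η / (1 + η * u)) ^ 2 * (B * C) = 2 * η * g + R ∧
      |R| ≤ 9 * η ^ 2 * C := by
  have hu2 : |u| ≤ 2 := abs_le_of_sq_le_sq (by linarith) (by norm_num)
  have hw : 99 / 100 ≤ 1 + η * u := by nlinarith [abs_le.1 hu2]
  set κ := η / (1 + η * u) with hκ
  have hκw : κ * (1 + η * u) = η := div_mul_cancel₀ _ (by linarith)
  have hκ0 : 0 < κ := div_pos hη0 (by linarith)
  have hκ1 : κ ≤ 100 / 99 * η := by nlinarith
  have hBX : B * X ≤ 6 := by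
    have := mul_le_mul (by linarith : B ≤ 3) hX hX0 (by norm_num)
    linarith
  have hg6 : g ^ 2 ≤ 6 * C := hg.trans (mul_le_mul_of_nonneg_right hBX hC)
  have hug : |u * g| ≤ 5 / 2 * C := by
    refine abs_le_of_sq_le_sq ?_ (by positivity)
    have h1 := mul_le_mul hu hg6 (sq_nonneg _) hC
    have h2 := sq_nonneg C
    rw [mul_pow, mul_pow]
    linarith
  -- The first summand comes from `κ = η - κηu`, the second is the quadratic term of the increment.
  refine ⟨-(2 * (κ * η) * (u * g)) + κ ^ 2 * (B * C), ?_, ?_⟩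
  · have : η - κ = κ * η * u := by linarith
    linear_combination (-2 * g) * this
  have hκη : κ * η ≤ 100 / 99 * η ^ 2 := by
    have := mul_le_mul_of_nonneg_right hκ1 hη0.le
    linarith
  have hκ2 : κ ^ 2 ≤ 51 / 49 * η ^ 2 := by
    have h1 := pow_le_pow_left₀ hκ0.le hκ1 2
    have h2 := sq_nonneg η
    rw [mul_pow] at h1
    linarith
  have h1 : |2 * (κ * η) * (u * g)| ≤ 2 * (100 / 99 * η ^ 2) * (5 / 2 * C) := by
    rw [abs_mul, abs_of_nonneg (by positivity : 0 ≤ 2 * (κ * η))]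
    exact mul_le_mul (by linarith) hug (abs_nonneg _) (by positivity)
  have h2 : κ ^ 2 * (B * C) ≤ 51 / 49 * η ^ 2 * (3 * C) :=
    mul_le_mul hκ2 (mul_le_mul_of_nonneg_right (by linarith) hC) (by positivity) (by positivity)
  have h3 : 0 ≤ κ ^ 2 * (B * C) := by positivity
  have h4 : 0 ≤ η ^ 2 * C := by positivity
  rw [abs_le] at h1 ⊢
  constructor <;> linarith

/-- Here `g` is the first-order part, `C` and `B` are the squared lengths of the along- and
off-vectors. The bound `g² ≤ B X C` puts a factor `X` into the `θ²η²` term, so that the contraction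
can absorb it. -/
theorem exp_increment_le {X C B g u η θ : ℝ} (hX0 : 0 ≤ X) (hX : X ≤ 2) (hC : 0 ≤ C) (hB : 0 ≤ B)
    (hCB : C + B ≤ 3) (hg : g ^ 2 ≤ B * X * C) (hu : u ^ 2 ≤ C) (hη0 : 0 < η) (hη : η ≤ 1 / 200)
    (hθ : 0 ≤ θ) (hθη : θ * η ≤ 1 / 10) :
    Real.exp (θ * (2 * (η / (1 + η * u)) * g + (η / (1 + η * u)) ^ 2 * (B * C))) ≤
      1 + 2 * θ * η * g + C * (28 / 3 * (θ * η ^ 2) + 24 * (θ ^ 2 * η ^ 2 * X)) := by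
  obtain ⟨R, hRw, hRabs⟩ := exists_increment_remainder hX0 hX hC hB hCB hg hu hη0 hη
  rw [hRw]
  clear hRw
  have hC3 : C ≤ 3 := by linarith
  have hg1 : g ^ 2 ≤ 3 * X * C :=
    hg.trans (mul_le_mul_of_nonneg_right (mul_le_mul_of_nonneg_right (by linarith) hX0) hC)
  have hgabs : |g| ≤ 17 / 4 := by
    refine abs_le_of_sq_le_sq ?_ (by norm_num)
    have := mul_le_mul hX hC3 hC (by norm_num)
    linarith
  have hRabs' : |R| ≤ 27 * η ^ 2 := by
    have := mul_le_mul_of_nonneg_left hC3 (sq_nonneg η)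
    linarith
  have hθη2 : θ * η ^ 2 ≤ 1 / 2000 := by
    have := mul_le_mul hθη hη hη0.le (by norm_num)
    linarith
  have hζ : |θ * (2 * η * g + R)| ≤ 1 := by
    rw [abs_mul, abs_of_nonneg hθ]
    have h1 : |2 * η * g + R| ≤ 2 * η * (17 / 4) + 27 * η ^ 2 := by
      refine (abs_add_le _ _).trans (add_le_add ?_ hRabs')
      rw [abs_mul, abs_of_nonneg (by positivity : 0 ≤ 2 * η)]
      exact mul_le_mul_of_nonneg_left hgabs (by positivity)
    have h2 := mul_le_mul_of_nonneg_left h1 hθ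
    linarith
  -- This is `exp ζ ≤ 1 + ζ + ζ²` for `|ζ| ≤ 1`; below, `ζ²` is split by `(p + q)² ≤ 2p² + 2q²`.
  have hexp := (abs_le.1 (Real.abs_exp_sub_one_sub_id_le hζ)).2
  have hR2 : R ^ 2 ≤ 243 * η ^ 4 * C := by
    have h1 : R ^ 2 ≤ (9 * η ^ 2 * C) ^ 2 := sq_le_sq' (abs_le.1 hRabs).1 (abs_le.1 hRabs).2
    have h2 : η ^ 4 * C * C ≤ η ^ 4 * C * 3 := mul_le_mul_of_nonneg_left hC3 (by positivity)
    linarith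
  have hsq : (θ * (2 * η * g + R)) ^ 2 ≤ θ ^ 2 * (8 * η ^ 2 * (3 * X * C) + 486 * η ^ 4 * C) := by
    rw [mul_pow]
    refine mul_le_mul_of_nonneg_left ?_ (sq_nonneg _)
    have h1 : η ^ 2 * g ^ 2 ≤ η ^ 2 * (3 * X * C) := mul_le_mul_of_nonneg_left hg1 (sq_nonneg _)
    have h2 := sq_nonneg (2 * η * g - R)
    linarith
  have h4 : (θ * η ^ 2) * (θ * η ^ 2 * C) ≤ 1 / 2000 * (θ * η ^ 2 * C) :=
    mul_le_mul_of_nonneg_right hθη2 (by positivity)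
  have h6 : 0 ≤ θ * η ^ 2 * C := by positivity
  have h7 : θ * R ≤ θ * (9 * η ^ 2 * C) := mul_le_mul_of_nonneg_left (abs_le.1 hRabs).2 hθ
  linarith

variable {n k m : ℕ} {D : Measure (EuclideanSpace ℝ (Fin n))} [IsProbabilityMeasure D]

theorem integrable_coord_mul (hD : ∀ᵐ x ∂D, ‖x‖ = 1) (i j : Fin n) :
    Integrable (fun x : EuclideanSpace ℝ (Fin n) => x i * x j) D := by
  refine Integrable.of_bound (C := 1) (by fun_prop) ?_
  filter_upwards [hD] with x hx
  rw [norm_mul]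
  exact mul_le_one₀ (hx ▸ PiLp.norm_apply_le x i) (norm_nonneg _) (hx ▸ PiLp.norm_apply_le x j)

theorem dotProduct_mulVec_eq_sum (N : Matrix (Fin n) (Fin n) ℝ) (x : Fin n → ℝ) :
    x ⬝ᵥ (N *ᵥ x) = ∑ i, ∑ j, N i j * (x j * x i) := by
  simp only [dotProduct, mulVec, Finset.mul_sum]
  exact Finset.sum_congr rfl fun i _ => Finset.sum_congr rfl fun j _ => by ring

theorem integrable_quadratic (hD : ∀ᵐ x ∂D, ‖x‖ = 1) (N : Matrix (Fin n) (Fin n) ℝ) :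
    Integrable (fun x : EuclideanSpace ℝ (Fin n) => x.ofLp ⬝ᵥ (N *ᵥ x.ofLp)) D := by
  simp_rw [dotProduct_mulVec_eq_sum]
  exact integrable_finsetSum _ fun i _ => integrable_finsetSum _ fun j _ =>
    (integrable_coord_mul hD j i).const_mul _

theorem integral_quadratic (hD : ∀ᵐ x ∂D, ‖x‖ = 1) (N : Matrix (Fin n) (Fin n) ℝ) :
    ∫ x, x.ofLp ⬝ᵥ (N *ᵥ x.ofLp) ∂D = (N * covariance D).trace := by
  simp_rw [dotProduct_mulVec_eq_sum]
  rw [integral_finsetSum Finset.univ (f := fun i (x : EuclideanSpace ℝ (Fin n)) =>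
    ∑ j, N i j * (x j * x i)) fun i _ => integrable_finsetSum _ fun j _ =>
    (integrable_coord_mul hD j i).const_mul _]
  simp only [trace, diag_apply, Matrix.mul_apply]
  refine Finset.sum_congr rfl fun i _ => ?_
  rw [integral_finsetSum Finset.univ (f := fun j (x : EuclideanSpace ℝ (Fin n)) =>
    N i j * (x j * x i)) fun j _ => (integrable_coord_mul hD j i).const_mul _]
  exact Finset.sum_congr rfl fun j _ => by rw [integral_const_mul]; rfl

theorem eigenvalue_nonneg (hD : ∀ᵐ x ∂D, ‖x‖ = 1) (i : Fin n) : 0 ≤ eigenvalue D i := by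
  obtain ⟨u, hu, hu1, -⟩ := exists_eigenbasis D
  have h1 : eigenvalue D i = u i ⬝ᵥ (covariance D *ᵥ u i) := by
    rw [hu, dotProduct_smul, hu1, smul_eq_mul, mul_one]
  have h2 : u i ⬝ᵥ (covariance D *ᵥ u i) = (vecMulVec (u i) (u i) * covariance D).trace := by
    rw [vecMulVec_mul, trace_vecMulVec, dotProduct_mulVec, dotProduct_comm]
  rw [h1, h2, ← integral_quadratic hD]
  refine integral_nonneg fun x => ?_
  rw [vecMulVec_mulVec, op_smul_eq_smul, dotProduct_smul, dotProduct_comm, smul_eq_mul]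
  exact mul_self_nonneg _

variable {V : Matrix (Fin n) (Fin k) ℝ} {Z : Matrix (Fin n) (Fin m) ℝ} {μ ν l : ℝ}

theorem sum_dotProduct_transpose (S : Matrix (Fin m) (Fin k) ℝ) :
    ∑ j, Sᵀ j ⬝ᵥ Sᵀ j = frobSq S := by
  rw [frobSq, Finset.sum_comm]
  exact Finset.sum_congr rfl fun j _ => Finset.sum_congr rfl fun i _ => (sq _).symm

theorem IsSplitting.trace_right_le {A : Matrix (Fin n) (Fin n) ℝ} (h : IsSplitting A V Z μ ν l)
    (S : Matrix (Fin m) (Fin k) ℝ) : ((Z * S)ᵀ * A * (Z * S)).trace ≤ ν * frobSq S := by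
  rw [trace_eq_sum_dotProduct, ← sum_dotProduct_transpose, Finset.mul_sum]
  exact Finset.sum_le_sum fun j _ => h.right_le (Sᵀ j)

theorem IsSplitting.le_trace_left {A : Matrix (Fin n) (Fin n) ℝ} (h : IsSplitting A V Z μ ν l)
    (S : Matrix (Fin m) (Fin k) ℝ) : μ * frobSq S ≤ ((V * Sᵀ)ᵀ * A * (V * Sᵀ)).trace := by
  rw [trace_eq_sum_dotProduct, ← frobSq_transpose, ← sum_dotProduct_transpose, Finset.mul_sum]
  exact Finset.sum_le_sum fun j _ => h.le_left (Sᵀᵀ j)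

theorem alongVec_eq_mulVec (S : Matrix (Fin m) (Fin k) ℝ) (x : Fin n → ℝ) :
    alongVec S (Vᵀ *ᵥ x) (Zᵀ *ᵥ x) = (V + Z * S)ᵀ *ᵥ x := by
  rw [alongVec, mulVec_mulVec, ← add_mulVec, transpose_add, transpose_mul]

theorem offVec_eq_mulVec (S : Matrix (Fin m) (Fin k) ℝ) (x : Fin n → ℝ) :
    offVec S (Vᵀ *ᵥ x) (Zᵀ *ᵥ x) = (Z - V * Sᵀ)ᵀ *ᵥ x := by
  rw [offVec, mulVec_mulVec, ← sub_mulVec, transpose_sub, transpose_mul, transpose_transpose]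

theorem along_dotProduct_eq (S : Matrix (Fin m) (Fin k) ℝ) (x : Fin n → ℝ) :
    alongVec S (Vᵀ *ᵥ x) (Zᵀ *ᵥ x) ⬝ᵥ alongVec S (Vᵀ *ᵥ x) (Zᵀ *ᵥ x) =
      x ⬝ᵥ (((V + Z * S) * (V + Z * S)ᵀ) *ᵥ x) := by
  rw [alongVec_eq_mulVec, ← mulVec_mulVec, dotProduct_mulVec_eq (V + Z * S)]

theorem off_dotProduct_eq (S : Matrix (Fin m) (Fin k) ℝ) (x : Fin n → ℝ) :
    offVec S (Vᵀ *ᵥ x) (Zᵀ *ᵥ x) ⬝ᵥ (S *ᵥ alongVec S (Vᵀ *ᵥ x) (Zᵀ *ᵥ x)) =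
      x ⬝ᵥ (((Z - V * Sᵀ) * (S * (V + Z * S)ᵀ)) *ᵥ x) := by
  rw [alongVec_eq_mulVec, offVec_eq_mulVec, ← mulVec_mulVec, ← mulVec_mulVec,
    dotProduct_mulVec_eq (Z - V * Sᵀ)]

theorem integral_along_le (hD : ∀ᵐ x ∂D, ‖x‖ = 1) (h : IsSplitting (covariance D) V Z μ ν l)
    (S : Matrix (Fin m) (Fin k) ℝ) :
    ∫ x, x.ofLp ⬝ᵥ (((V + Z * S) * (V + Z * S)ᵀ) *ᵥ x.ofLp) ∂D ≤ l + ν * frobSq S := by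
  rw [integral_quadratic hD, Matrix.mul_assoc, trace_mul_comm]
  have h1 : (V + Z * S)ᵀ * covariance D * (V + Z * S) =
      Vᵀ * covariance D * V + Vᵀ * covariance D * Z * S + Sᵀ * (Zᵀ * covariance D * V) +
        (Z * S)ᵀ * covariance D * (Z * S) := by
    simp only [transpose_add, transpose_mul, Matrix.add_mul, Matrix.mul_add, Matrix.mul_assoc]
    abel
  rw [h1, h.left_cross, h.right_cross, Matrix.zero_mul, Matrix.mul_zero, add_zero, add_zero,
    trace_add]
  exact add_le_add h.trace_le (h.trace_right_le S)

/-- The off-diagonal blocks of the covariance vanish, leaving the lower block's form on the columns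
of `S` (at most `ν‖S‖²`) minus the upper block's form on the columns of `Sᵀ` (at least `μ‖S‖²`). -/
theorem integral_drift_le (hD : ∀ᵐ x ∂D, ‖x‖ = 1) (h : IsSplitting (covariance D) V Z μ ν l)
    (S : Matrix (Fin m) (Fin k) ℝ) :
    ∫ x, x.ofLp ⬝ᵥ (((Z - V * Sᵀ) * (S * (V + Z * S)ᵀ)) *ᵥ x.ofLp) ∂D ≤
      -((μ - ν) * frobSq S) := by
  rw [integral_quadratic hD, Matrix.mul_assoc, trace_mul_comm]
  have h1 : S * (V + Z * S)ᵀ * covariance D * (Z - V * Sᵀ) =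
      S * (Vᵀ * covariance D * Z) - S * Sᵀ * (Zᵀ * covariance D * V) * Sᵀ +
        S * ((Z * S)ᵀ * covariance D * Z) - (V * Sᵀ)ᵀ * covariance D * (V * Sᵀ) := by
    simp only [transpose_add, transpose_mul, transpose_transpose, Matrix.add_mul, Matrix.mul_add,
      Matrix.mul_sub, Matrix.mul_assoc]
    abel
  have h2 : (S * ((Z * S)ᵀ * covariance D * Z)).trace =
      ((Z * S)ᵀ * covariance D * (Z * S)).trace := by
    rw [trace_mul_comm, Matrix.mul_assoc, Matrix.mul_assoc]
  rw [h1, h.left_cross, h.right_cross, Matrix.mul_zero, Matrix.mul_zero, Matrix.zero_mul, sub_zero,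
    zero_add, trace_sub, h2]
  have h3 := h.trace_right_le S
  have h4 := h.le_trace_left S
  linarith

theorem IsSplitting.parseval {A : Matrix (Fin n) (Fin n) ℝ} (h : IsSplitting A V Z μ ν l)
    {x : EuclideanSpace ℝ (Fin n)} (hx : ‖x‖ = 1) :
    (Vᵀ *ᵥ x.ofLp) ⬝ᵥ (Vᵀ *ᵥ x.ofLp) + (Zᵀ *ᵥ x.ofLp) ⬝ᵥ (Zᵀ *ᵥ x.ofLp) = 1 := by
  have h1 : x.ofLp ⬝ᵥ x.ofLp = 1 := by
    have h2 : inner ℝ x x = (1 : ℝ) := by rw [real_inner_self_eq_norm_sq, hx]; norm_num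
    rwa [EuclideanSpace.inner_eq_star_dotProduct, star_trivial] at h2
  rw [← dotProduct_mulVec_eq, ← dotProduct_mulVec_eq, mulVec_mulVec, mulVec_mulVec,
    ← dotProduct_add, ← add_mulVec, h.complete, one_mulVec, h1]

theorem dotProduct_alongVec_sq_le (S : Matrix (Fin m) (Fin k) ℝ) {a : Fin k → ℝ}
    {b : Fin m → ℝ} (hab : a ⬝ᵥ a + b ⬝ᵥ b = 1) :
    (a ⬝ᵥ alongVec S a b) ^ 2 ≤ alongVec S a b ⬝ᵥ alongVec S a b :=
  (dotProduct_sq_le _ _).trans (mul_le_of_le_one_left (dotProduct_self_nonneg' _)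
    (by linarith [dotProduct_self_nonneg' b]))

/-- The exponential moment of the potential after one step from a state of potential at most
`2`. -/
theorem lintegral_exp_update_le (hD : ∀ᵐ x ∂D, ‖x‖ = 1)
    (h : IsSplitting (covariance D) V Z μ ν l) (hl : 0 ≤ l) (hν : ν ≤ l)
    {S : Matrix (Fin m) (Fin k) ℝ} (hS : frobSq S ≤ 2) {η θ : ℝ} (hη0 : 0 < η)
    (hη : η ≤ 1 / 200) (hθ : 0 ≤ θ) (hθη : θ * η ≤ 1 / 10) :
    ∫⁻ x, ENNReal.ofReal (Real.exp
      (θ * frobSq (update η S (Vᵀ *ᵥ x.ofLp) (Zᵀ *ᵥ x.ofLp)))) ∂D ≤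
    ENNReal.ofReal (Real.exp
      (θ * ((1 - 2 * η * (μ - ν) + 72 * θ * η ^ 2 * l) * frobSq S + 28 * η ^ 2 * l))) := by
  set X := frobSq S with hX
  have hX0 : 0 ≤ X := frobSq_nonneg S
  set N := (Z - V * Sᵀ) * (S * (V + Z * S)ᵀ)
  set M := (V + Z * S) * (V + Z * S)ᵀ
  set w := 28 / 3 * (θ * η ^ 2) + 24 * (θ ^ 2 * η ^ 2 * X)
  have hw : 0 ≤ w := by positivity
  let f : EuclideanSpace ℝ (Fin n) → ℝ := fun x => Real.exp (θ * X) *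
    (1 + 2 * θ * η * (x.ofLp ⬝ᵥ (N *ᵥ x.ofLp)) + w * (x.ofLp ⬝ᵥ (M *ᵥ x.ofLp)))
  have hpt : ∀ᵐ x ∂D, Real.exp (θ * frobSq (update η S (Vᵀ *ᵥ x.ofLp) (Zᵀ *ᵥ x.ofLp))) ≤ f x := by
    filter_upwards [hD] with x hx
    have hab := h.parseval hx
    have h1 := alongVec_add_offVec_le S _ _ hab
    have h2 := exp_increment_le hX0 hS (dotProduct_self_nonneg' _) (dotProduct_self_nonneg' _)
      (h1.trans (by linarith)) (dotProduct_mulVec_sq_le S _ _)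
      (dotProduct_alongVec_sq_le S hab) hη0 hη hθ hθη
    rw [update, frobSq_add_smul_vecMulVec, mul_add, Real.exp_add]
    refine mul_le_mul_of_nonneg_left (h2.trans (le_of_eq ?_)) (Real.exp_nonneg _)
    rw [off_dotProduct_eq, along_dotProduct_eq]
    ring
  have hN := integrable_quadratic hD N
  have hM := integrable_quadratic hD M
  have hi1 : Integrable (fun x : EuclideanSpace ℝ (Fin n) =>
      1 + 2 * θ * η * (x.ofLp ⬝ᵥ (N *ᵥ x.ofLp))) D :=
    (integrable_const _).add (hN.const_mul _)
  have hi2 : Integrable (fun x : EuclideanSpace ℝ (Fin n) =>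
      w * (x.ofLp ⬝ᵥ (M *ᵥ x.ofLp))) D := hM.const_mul _
  have hf : Integrable f D := (hi1.add hi2).const_mul _
  have hint : ∫ x, f x ∂D ≤ Real.exp (θ * ((1 - 2 * η * (μ - ν) + 72 * θ * η ^ 2 * l) * X +
      28 * η ^ 2 * l)) := by
    have h1 : ∫ x, f x ∂D = Real.exp (θ * X) * (1 + 2 * θ * η *
        (∫ x, x.ofLp ⬝ᵥ (N *ᵥ x.ofLp) ∂D) + w * ∫ x, x.ofLp ⬝ᵥ (M *ᵥ x.ofLp) ∂D) := by
      simp only [f]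
      rw [integral_const_mul, integral_add hi1 hi2,
        integral_add (integrable_const _) (hN.const_mul _), integral_const_mul,
        integral_const_mul]
      simp
    have h2 := mul_le_mul_of_nonneg_left (integral_drift_le hD h S)
      (by positivity : 0 ≤ 2 * θ * η)
    -- `l + νX ≤ 3l` because `ν ≤ l` and `X ≤ 2`; this turns the constants `28/3` and `24` into `28`
    -- and `72`.
    have h3 : w * ∫ x, x.ofLp ⬝ᵥ (M *ᵥ x.ofLp) ∂D ≤ w * (3 * l) := by
      refine mul_le_mul_of_nonneg_left ((integral_along_le hD h S).trans ?_) hw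
      have : ν * X ≤ l * X := mul_le_mul_of_nonneg_right hν hX0
      nlinarith
    rw [h1]
    set e := -(2 * θ * η * ((μ - ν) * X)) + w * (3 * l)
    have h4 := Real.add_one_le_exp e
    calc _ ≤ Real.exp (θ * X) * Real.exp e := by
          refine mul_le_mul_of_nonneg_left ?_ (Real.exp_nonneg _)
          linarith
      _ = _ := by
          rw [← Real.exp_add]
          congr 1
          simp only [e, w]
          ring
  calc _ ≤ ∫⁻ x, ENNReal.ofReal (f x) ∂D :=
        lintegral_mono_ae (hpt.mono fun x hx => ENNReal.ofReal_le_ofReal hx)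
    _ = ENNReal.ofReal (∫ x, f x ∂D) :=
        (ofReal_integral_eq_lintegral_ofReal hf
          (hpt.mono fun x hx => (Real.exp_nonneg _).trans hx)).symm
    _ ≤ _ := ENNReal.ofReal_le_ofReal hint

end Moment

/-! ### A maximal inequality for recursions with independent inputs. -/

section Maximal

variable {σ E Ω : Type*}

/-- The state reached after `t` steps of the recursion `F` driven by the inputs `q`. -/
def stateAt (F : ℕ → σ → E → σ) (s₀ : σ) (q : ℕ → E) : ℕ → σ
  | 0 => s₀
  | t + 1 => F t (stateAt F s₀ q t) (q t)

theorem stateAt_congr (F : ℕ → σ → E → σ) (s₀ : σ) {q q' : ℕ → E} {t : ℕ}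
    (h : ∀ i < t, q i = q' i) : stateAt F s₀ q t = stateAt F s₀ q' t := by
  induction t with
  | zero => rfl
  | succ t ih =>
    rw [stateAt, stateAt, ih fun i hi => h i (by omega), h t (by omega)]

variable [MeasurableSpace σ] [MeasurableSpace E] [MeasurableSpace Ω]

theorem measurable_stateAt {F : ℕ → σ → E → σ} (hF : ∀ t, Measurable fun p : σ × E => F t p.1 p.2)
    (s₀ : σ) (t : ℕ) : Measurable fun q : ℕ → E => stateAt F s₀ q t := by
  induction t with
  | zero => exact measurable_const
  | succ t ih => exact (hF t).comp (ih.prodMk (measurable_pi_apply t))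

/-- Integrating out the current input, which is independent of the past ones. -/
theorem lintegral_past_present [Inhabited E] {P : Measure Ω} [IsProbabilityMeasure P]
    {D : Measure E} {y : ℕ → Ω → E} (hy : ∀ t, Measurable (y t)) (hlaw : ∀ t, P.map (y t) = D)
    (hind : iIndepFun y P) (t : ℕ) {H : (ℕ → E) → E → ENNReal}
    (hH : Measurable fun p : (ℕ → E) × E => H p.1 p.2)
    (hcongr : ∀ q q' : ℕ → E, (∀ i < t, q i = q' i) → H q = H q') :
    ∫⁻ ω, H (fun i => y i ω) (y t ω) ∂P = ∫⁻ ω, ∫⁻ x, H (fun i => y i ω) x ∂D ∂P := by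
  -- The inputs from time `t` on are replaced by a default value, which `H` does not see by
  -- `hcongr`; the past becomes a function of finitely many inputs.
  let ext : (Finset.range t → E) → ℕ → E := fun p i =>
    if h : i ∈ Finset.range t then p ⟨i, h⟩ else default
  have hext : Measurable ext := by
    refine measurable_pi_lambda _ fun i => ?_
    by_cases h : i ∈ Finset.range t
    · simpa only [ext, dif_pos h] using measurable_pi_apply (⟨i, h⟩ : Finset.range t)
    · simpa only [ext, dif_neg h] using measurable_const
  let Y : Ω → ℕ → E := fun ω => ext fun i => y i ω
  have hY : Measurable Y := hext.comp (measurable_pi_lambda _ fun i => hy i)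
  have hYy : ∀ ω, H (fun i => y i ω) = H (Y ω) := fun ω =>
    hcongr _ _ fun i hi => by simp [Y, ext, hi]
  have hindep : IndepFun Y (y t) P :=
    (hind.indepFun_finset (Finset.range t) {t} (by simp) hy).comp hext
      (measurable_pi_apply (⟨t, Finset.mem_singleton_self t⟩ : ({t} : Finset ℕ)))
  have : IsProbabilityMeasure D := hlaw t ▸ Measure.isProbabilityMeasure_map (hy t).aemeasurable
  simp_rw [hYy]
  have h1 : ∫⁻ ω, H (Y ω) (y t ω) ∂P =
      ∫⁻ p, H p.1 p.2 ∂(P.map fun ω => (Y ω, y t ω)) :=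
    (lintegral_map hH (hY.prodMk (hy t))).symm
  rw [h1, (indepFun_iff_map_prod_eq_prod_map_map hY.aemeasurable (hy t).aemeasurable).1 hindep,
    hlaw, lintegral_prod _ hH.aemeasurable, lintegral_map hH.lintegral_prod_right' hY]

/-- A maximal inequality for a recursion driven by independent inputs: if `Φ` does not increase on
average as long as the state stays in `G`, then `Φ 0 s₀` bounds the probability of reaching a
state in `B`, where `Φ` is at least `1`, before leaving `G`. -/
theorem measure_hit_le [Inhabited E] {P : Measure Ω} [IsProbabilityMeasure P]
    {D : Measure E} {y : ℕ → Ω → E} (hy : ∀ t, Measurable (y t)) (hlaw : ∀ t, P.map (y t) = D)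
    (hind : iIndepFun y P) {F : ℕ → σ → E → σ}
    (hF : ∀ t, Measurable fun p : σ × E => F t p.1 p.2) (s₀ : σ) {G B : ℕ → Set σ}
    (hG : ∀ t, MeasurableSet (G t)) (hB : ∀ t, MeasurableSet (B t)) {Φ : ℕ → σ → ENNReal}
    (hΦ : ∀ t, Measurable (Φ t)) (T : ℕ)
    (hstep : ∀ t < T, ∀ s ∈ G t, ∫⁻ x, Φ (t + 1) (F t s x) ∂D ≤ Φ t s)
    (hone : ∀ t ≤ T, ∀ s ∈ B t, 1 ≤ Φ t s) :
    P {ω | ∃ t ≤ T, stateAt F s₀ (fun i => y i ω) t ∈ B t ∧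
      ∀ r < t, stateAt F s₀ (fun i => y i ω) r ∈ G r} ≤ Φ 0 s₀ := by
  have : IsProbabilityMeasure D := hlaw 0 ▸ Measure.isProbabilityMeasure_map (hy 0).aemeasurable
  let st : ℕ → (ℕ → E) → σ := fun t q => stateAt F s₀ q t
  have hst : ∀ t, Measurable (st t) := measurable_stateAt hF s₀
  let yy : Ω → ℕ → E := fun ω i => y i ω
  have hyy : Measurable yy := measurable_pi_lambda _ hy
  -- `A t` says that the process is still running at time `t`, and `H t` below that it was stopped
  -- in `B` before `t`.
  let A : ℕ → Set (ℕ → E) := fun t => {q | ∀ r < t, st r q ∈ G r \ B r}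
  have hA : ∀ t, MeasurableSet (A t) := fun t => by
    have : A t = ⋂ r, ⋂ _ : r < t, st r ⁻¹' (G r \ B r) := by ext; simp [A]
    rw [this]
    exact MeasurableSet.iInter fun r => MeasurableSet.iInter fun _ =>
      hst r ((hG r).diff (hB r))
  let H : ℕ → Set (ℕ → E) := fun t =>
    {q | ∃ r < t, st r q ∈ B r ∧ ∀ i < r, st i q ∈ G i \ B i}
  have hAst : ∀ t, A (t + 1) ⊆ A t := fun t q hq r hr => hq r (by omega)
  -- The supermartingale property of the stopped process: `e1` integrates out the input at time `t`,
  -- and `e2` pays for paths stopped at time `t` with their value `Φ ≥ 1`.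
  have key : ∀ t ≤ T, P (yy ⁻¹' H t) + ∫⁻ ω, (A t).indicator (fun q => Φ t (st t q)) (yy ω) ∂P
      ≤ Φ 0 s₀ := by
    intro t
    induction t with
    | zero =>
      intro _
      have h0 : H 0 = ∅ := by ext; simp [H]
      have h1 : A 0 = Set.univ := by ext; simp [A]
      simp [h0, h1, st, stateAt]
    | succ t ih =>
      intro ht
      refine le_trans ?_ (ih (by omega))
      have hH : H (t + 1) ⊆ H t ∪ (A t ∩ st t ⁻¹' B t) := by
        rintro q ⟨r, hr, h1, h2⟩
        rcases Nat.lt_succ_iff_lt_or_eq.1 hr with h | rfl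
        · exact Or.inl ⟨r, h, h1, h2⟩
        · exact Or.inr ⟨h2, h1⟩
      have hAB : MeasurableSet (A t ∩ st t ⁻¹' B t) := (hA t).inter (hst t (hB t))
      have e1 : ∫⁻ ω, (A (t + 1)).indicator (fun q => Φ (t + 1) (st (t + 1) q)) (yy ω) ∂P
          ≤ ∫⁻ ω, (A (t + 1)).indicator (fun q => Φ t (st t q)) (yy ω) ∂P := by
        have hmeas : Measurable fun p : (ℕ → E) × E => (A (t + 1)).indicator
            (fun q => Φ (t + 1) (F t (st t q) p.2)) p.1 := by
          have h1 : Measurable fun p : (ℕ → E) × E => Φ (t + 1) (F t (st t p.1) p.2) :=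
            (hΦ _).comp ((hF t).comp (((hst t).comp measurable_fst).prodMk measurable_snd))
          exact h1.indicator (measurable_fst (hA (t + 1)))
        have h2 := lintegral_past_present hy hlaw hind t
          (H := fun q x => (A (t + 1)).indicator (fun q => Φ (t + 1) (F t (st t q) x)) q)
          hmeas (by
            intro q q' hqq
            have hs : ∀ r ≤ t, st r q = st r q' := fun r hr =>
              stateAt_congr F s₀ fun i hi => hqq i (by omega)
            have hmem : q ∈ A (t + 1) ↔ q' ∈ A (t + 1) :=
              forall₂_congr fun r hr => by rw [hs r (by omega)]
            funext x
            by_cases hq : q ∈ A (t + 1)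
            · rw [Set.indicator_of_mem hq, Set.indicator_of_mem (hmem.1 hq), hs t le_rfl]
            · rw [Set.indicator_of_notMem hq, Set.indicator_of_notMem (mt hmem.2 hq)])
        refine h2.trans_le (lintegral_mono fun ω => ?_)
        by_cases hq : yy ω ∈ A (t + 1)
        · simp only [yy] at hq
          simp only [Set.indicator_of_mem hq, yy]
          exact hstep t (by omega) _ (hq t (by omega)).1
        · simp only [yy] at hq
          simp [Set.indicator_of_notMem hq]
      have e2 : P (yy ⁻¹' (A t ∩ st t ⁻¹' B t)) +
          ∫⁻ ω, (A (t + 1)).indicator (fun q => Φ t (st t q)) (yy ω) ∂P ≤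
          ∫⁻ ω, (A t).indicator (fun q => Φ t (st t q)) (yy ω) ∂P := by
        rw [← lintegral_indicator_one (hyy hAB), ← lintegral_add_left
          (measurable_one.indicator (hyy hAB))]
        refine lintegral_mono fun ω => ?_
        by_cases h1 : yy ω ∈ A t
        · by_cases h2 : st t (yy ω) ∈ B t
          · have h3 : yy ω ∉ A (t + 1) := fun h => (h t (by omega)).2 h2
            have h4 : ω ∈ yy ⁻¹' (A t ∩ st t ⁻¹' B t) := ⟨h1, h2⟩
            rw [Set.indicator_of_notMem h3, Set.indicator_of_mem h1, Set.indicator_of_mem h4,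
              add_zero]
            exact hone t (by omega) _ h2
          · have : (yy ⁻¹' (A t ∩ st t ⁻¹' B t)).indicator (1 : Ω → ENNReal) ω = 0 :=
              Set.indicator_of_notMem (fun h => h2 h.2) _
            rw [this, zero_add]
            exact Set.indicator_le_indicator_of_subset (hAst t) (fun _ => zero_le) _
        · have h3 : yy ω ∉ A (t + 1) := fun h => h1 (hAst t h)
          have : (yy ⁻¹' (A t ∩ st t ⁻¹' B t)).indicator (1 : Ω → ENNReal) ω = 0 :=
              Set.indicator_of_notMem (fun h => h1 h.1) _
          rw [this, Set.indicator_of_notMem h3, zero_add]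
          exact zero_le
      calc P (yy ⁻¹' H (t + 1)) +
            ∫⁻ ω, (A (t + 1)).indicator (fun q => Φ (t + 1) (st (t + 1) q)) (yy ω) ∂P
          ≤ (P (yy ⁻¹' H t) + P (yy ⁻¹' (A t ∩ st t ⁻¹' B t))) +
            ∫⁻ ω, (A (t + 1)).indicator (fun q => Φ t (st t q)) (yy ω) ∂P := by
            gcongr
            exact (measure_mono (Set.preimage_mono hH)).trans (measure_union_le _ _)
        _ ≤ _ := by
            rw [add_assoc]
            gcongr
  have hfinal : {ω | ∃ t ≤ T, stateAt F s₀ (fun i => y i ω) t ∈ B t ∧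
      ∀ r < t, stateAt F s₀ (fun i => y i ω) r ∈ G r} ⊆
      yy ⁻¹' H T ∪ yy ⁻¹' (A T ∩ st T ⁻¹' B T) := by
    rintro ω ⟨t, ht, h1, h2⟩
    classical
    have hex : ∃ t, st t (yy ω) ∈ B t := ⟨t, h1⟩
    have hle : Nat.find hex ≤ t := Nat.find_min' hex h1
    have hG' : ∀ i < Nat.find hex, st i (yy ω) ∈ G i \ B i := fun i hi =>
      ⟨h2 i (by omega), Nat.find_min hex hi⟩
    rcases lt_or_eq_of_le (hle.trans ht) with h | h
    · exact Or.inl ⟨_, h, Nat.find_spec hex, hG'⟩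
    · refine Or.inr ⟨fun i hi => hG' i (by omega), ?_⟩
      have := Nat.find_spec hex
      rwa [h] at this
  refine (measure_mono hfinal).trans ((measure_union_le _ _).trans
    (le_trans ?_ (key T le_rfl)))
  gcongr
  have hAB : MeasurableSet (A T ∩ st T ⁻¹' B T) := (hA T).inter (hst T (hB T))
  rw [← lintegral_indicator_one (hyy hAB)]
  refine lintegral_mono fun ω => ?_
  by_cases h : ω ∈ yy ⁻¹' (A T ∩ st T ⁻¹' B T)
  · rw [Set.indicator_of_mem h, Set.indicator_of_mem h.1]
    exact hone T le_rfl _ h.2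
  · rw [Set.indicator_of_notMem h]
    exact zero_le

end Maximal

/-! ### Oja's algorithm as a recursion for `S`, and its learning rates. -/

section Recursion

variable {n k m : ℕ}

/-- The recursion satisfied by `Zᵀ W_t (Vᵀ W_t)⁻¹` along Oja's algorithm. -/
noncomputable def ojaStep (V : Matrix (Fin n) (Fin k) ℝ) (Z : Matrix (Fin n) (Fin m) ℝ)
    (η : ℕ → ℝ) (t : ℕ) (S : Matrix (Fin m) (Fin k) ℝ) (x : EuclideanSpace ℝ (Fin n)) :
    Matrix (Fin m) (Fin k) ℝ :=
  update (η t) S (Vᵀ *ᵥ x.ofLp) (Zᵀ *ᵥ x.ofLp)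

instance instMeasurableSpaceMatrix : MeasurableSpace (Matrix (Fin m) (Fin k) ℝ) :=
  inferInstanceAs (MeasurableSpace (Fin m → Fin k → ℝ))

theorem measurable_entry (i : Fin m) (j : Fin k) :
    Measurable fun S : Matrix (Fin m) (Fin k) ℝ => S i j :=
  (measurable_pi_apply j).comp (measurable_pi_apply (X := fun _ : Fin m => Fin k → ℝ) i)

theorem measurable_of_entry {α : Type*} [MeasurableSpace α] {f : α → Matrix (Fin m) (Fin k) ℝ}
    (h : ∀ i j, Measurable fun a => f a i j) : Measurable f :=
  measurable_pi_lambda (X := fun _ : Fin m => Fin k → ℝ) _ fun i =>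
    measurable_pi_lambda _ fun j => h i j

theorem measurable_frobSq : Measurable (frobSq : Matrix (Fin m) (Fin k) ℝ → ℝ) := by
  unfold frobSq
  refine Finset.measurable_sum _ fun i _ => Finset.measurable_sum _ fun j _ => ?_
  exact (measurable_entry i j).pow_const 2

theorem measurable_ojaStep (V : Matrix (Fin n) (Fin k) ℝ) (Z : Matrix (Fin n) (Fin m) ℝ)
    (η : ℕ → ℝ) (t : ℕ) : Measurable fun p : Matrix (Fin m) (Fin k) ℝ × EuclideanSpace ℝ (Fin n) =>
      ojaStep V Z η t p.1 p.2 := by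
  have hS : ∀ i j, Measurable fun p : Matrix (Fin m) (Fin k) ℝ × EuclideanSpace ℝ (Fin n) =>
      p.1 i j := fun i j =>
    (measurable_entry i j).comp measurable_fst
  have hx : ∀ i, Measurable fun p : Matrix (Fin m) (Fin k) ℝ × EuclideanSpace ℝ (Fin n) =>
      p.2.ofLp i := fun i => by fun_prop
  refine measurable_of_entry fun i j => ?_
  simp only [ojaStep, update, alongVec, offVec, Matrix.add_apply, Matrix.smul_apply,
    vecMulVec_apply, dotProduct, mulVec, Pi.add_apply, Pi.sub_apply, smul_eq_mul,
    Matrix.transpose_apply]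
  fun_prop

variable {V : Matrix (Fin n) (Fin k) ℝ} {Z : Matrix (Fin n) (Fin m) ℝ} {μ ν l : ℝ}

/-- While the potential is at most `2`, the denominator `1 + η u` of the update has `|u| ≤ 2`, hence
stays positive and `Vᵀ W` stays invertible. -/
theorem stateAt_ojaStep_eq {A : Matrix (Fin n) (Fin n) ℝ} (h : IsSplitting A V Z μ ν l)
    {η : ℕ → ℝ} (hη0 : ∀ t, 0 < η t) (hη : ∀ t, η t ≤ 1 / 200)
    {q : ℕ → EuclideanSpace ℝ (Fin n)} (hq : ∀ t, ‖q t‖ = 1) {W₀ : Matrix (Fin n) (Fin k) ℝ}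
    (hW : IsUnit (Vᵀ * W₀)) {S₀ : Matrix (Fin m) (Fin k) ℝ}
    (hS₀ : S₀ = Zᵀ * W₀ * (Vᵀ * W₀)⁻¹) (t : ℕ)
    (ht : ∀ r < t, frobSq (stateAt (ojaStep V Z η) S₀ q r) ≤ 2) :
    IsUnit (Vᵀ * oja η q W₀ t) ∧ stateAt (ojaStep V Z η) S₀ q t =
      Zᵀ * oja η q W₀ t * (Vᵀ * oja η q W₀ t)⁻¹ := by
  induction t with
  | zero => exact ⟨hW, hS₀⟩
  | succ t ih =>
    obtain ⟨h1, h2⟩ := ih fun r hr => ht r (by omega)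
    refine oja_step h.complete h1 (q t).ofLp (η t) h2 ?_
    set S := stateAt (ojaStep V Z η) S₀ q t
    have hab := h.parseval (hq t)
    have h3 := alongVec_add_offVec_le S _ _ hab
    have h4 := dotProduct_alongVec_sq_le S hab
    have h5 := ht t (by omega)
    have h6 := dotProduct_self_nonneg' (offVec S (Vᵀ *ᵥ (q t).ofLp) (Zᵀ *ᵥ (q t).ofLp))
    have h7 : |(Vᵀ *ᵥ (q t).ofLp) ⬝ᵥ alongVec S (Vᵀ *ᵥ (q t).ofLp) (Zᵀ *ᵥ (q t).ofLp)| ≤ 2 :=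
      abs_le_of_sq_le_sq (by linarith) (by norm_num)
    have h8 := mul_le_mul_of_nonneg_left (abs_le.1 h7).1 (hη0 t).le
    have h9 := hη t
    intro h0
    linarith

/-- A failure of the bound `r` on the potential means that the recursion has exceeded the level
`2`, or exceeds the level `r` without having exceeded `2` before. -/
theorem exceed_of_not_potentialLE {A : Matrix (Fin n) (Fin n) ℝ} (h : IsSplitting A V Z μ ν l)
    {η : ℕ → ℝ} (hη0 : ∀ t, 0 < η t) (hη : ∀ t, η t ≤ 1 / 200)
    {q : ℕ → EuclideanSpace ℝ (Fin n)} (hq : ∀ t, ‖q t‖ = 1) {W₀ : Matrix (Fin n) (Fin k) ℝ}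
    (hW : IsUnit (Vᵀ * W₀)) {S₀ : Matrix (Fin m) (Fin k) ℝ}
    (hS₀ : S₀ = Zᵀ * W₀ * (Vᵀ * W₀)⁻¹) {t : ℕ} {r : ℝ}
    (hnot : ¬ PotentialLE V Z (oja η q W₀ t) r) :
    (∃ s, 2 < frobSq (stateAt (ojaStep V Z η) S₀ q s) ∧
      ∀ i < s, frobSq (stateAt (ojaStep V Z η) S₀ q i) ≤ 2) ∨
    (r < frobSq (stateAt (ojaStep V Z η) S₀ q t) ∧
      ∀ i < t, frobSq (stateAt (ojaStep V Z η) S₀ q i) ≤ 2) := by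
  classical
  by_cases hex : ∃ s, 2 < frobSq (stateAt (ojaStep V Z η) S₀ q s)
  · exact Or.inl ⟨Nat.find hex, Nat.find_spec hex, fun i hi => not_lt.1 (Nat.find_min hex hi)⟩
  · push Not at hex
    refine Or.inr ⟨?_, fun i _ => hex i⟩
    obtain ⟨h1, h2⟩ := stateAt_ojaStep_eq h hη0 hη hq hW hS₀ t fun i _ => hex i
    by_contra hle
    exact hnot ⟨h1, by rw [potential_eq_frobSq, ← h2]; exact not_lt.1 hle⟩

variable {D : Measure (EuclideanSpace ℝ (Fin n))} {Ω : Type*} [MeasurableSpace Ω] {P : Measure Ω}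
  [IsProbabilityMeasure P] {y : ℕ → Ω → EuclideanSpace ℝ (Fin n)}

/-- The potential exceeds the levels `r`, within a set `I` of times up to `T` and before it exceeds
`2`, with a probability that is bounded by an exponential supermartingale. -/
theorem measure_exceed_le (hD : ∀ᵐ x ∂D, ‖x‖ = 1) (h : IsSplitting (covariance D) V Z μ ν l)
    (hl : 0 ≤ l) (hν : ν ≤ l) (hy : ∀ t, Measurable (y t)) (hlaw : ∀ t, P.map (y t) = D)
    (hind : iIndepFun y P) {η : ℕ → ℝ} (hη0 : ∀ t, 0 < η t) (hη : ∀ t, η t ≤ 1 / 200)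
    (S₀ : Matrix (Fin m) (Fin k) ℝ) (I : Set ℕ) (r θ c : ℕ → ℝ) (T : ℕ)
    (hθ : ∀ t ≤ T, 0 ≤ θ t) (hθη : ∀ t < T, θ (t + 1) * η t ≤ 1 / 10)
    (hstep : ∀ t < T, ∀ X, 0 ≤ X → X ≤ 2 →
      θ (t + 1) * ((1 - 2 * η t * (μ - ν) + 72 * θ (t + 1) * η t ^ 2 * l) * X +
        28 * η t ^ 2 * l) + c (t + 1) ≤ θ t * X + c t)
    (hlevel : ∀ t ≤ T, t ∈ I → 0 ≤ θ t * r t + c t) :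
    P {ω | ∃ t ≤ T, t ∈ I ∧ r t < frobSq (stateAt (ojaStep V Z η) S₀ (fun i => y i ω) t) ∧
      ∀ i < t, frobSq (stateAt (ojaStep V Z η) S₀ (fun i => y i ω) i) ≤ 2} ≤
    ENNReal.ofReal (Real.exp (θ 0 * frobSq S₀ + c 0)) := by
  have : IsProbabilityMeasure D := hlaw 0 ▸ Measure.isProbabilityMeasure_map (hy 0).aemeasurable
  let B : ℕ → Set (Matrix (Fin m) (Fin k) ℝ) := fun t => {S | t ∈ I ∧ r t < frobSq S}
  have hB : ∀ t, MeasurableSet (B t) := fun t =>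
    (MeasurableSet.const _).inter (measurableSet_lt measurable_const measurable_frobSq)
  have hmain := measure_hit_le hy hlaw hind (measurable_ojaStep V Z η) S₀
    (G := fun _ => {S | frobSq S ≤ 2}) (B := B)
    (Φ := fun t S => ENNReal.ofReal (Real.exp (θ t * frobSq S + c t)))
    (fun _ => measurableSet_le measurable_frobSq measurable_const) hB
    (fun t => ENNReal.measurable_ofReal.comp (Real.measurable_exp.comp
      ((measurable_frobSq.const_mul _).add_const _))) T ?_ ?_
  · refine (measure_mono ?_).trans hmain
    rintro ω ⟨t, ht, hI, h1, h2⟩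
    exact ⟨t, ht, ⟨hI, h1⟩, h2⟩
  · intro t ht S hS
    have h1 := lintegral_exp_update_le hD h hl hν hS (hη0 t) (hη t) (hθ (t + 1) ht) (hθη t ht)
    simp_rw [Real.exp_add, ENNReal.ofReal_mul (Real.exp_nonneg _)]
    rw [lintegral_mul_const' _ _ ENNReal.ofReal_ne_top]
    refine (mul_le_mul_left h1 _).trans ?_
    rw [← ENNReal.ofReal_mul (Real.exp_nonneg _), ← ENNReal.ofReal_mul (Real.exp_nonneg _),
      ← Real.exp_add, ← Real.exp_add]
    exact ENNReal.ofReal_le_ofReal (Real.exp_le_exp.2 (hstep t ht _ (frobSq_nonneg S) hS))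
  · rintro t ht S ⟨hI, hS⟩
    rw [ENNReal.one_le_ofReal, Real.one_le_exp_iff]
    have := mul_le_mul_of_nonneg_left hS.le (hθ t ht)
    linarith [hlevel t ht hI]

/-- The offset of the learning rates. -/
noncomputable def offset (G l L : ℝ) : ℝ := 400 * l * L / G ^ 2

/-- The learning rates. -/
noncomputable def rate (G l L : ℝ) (t : ℕ) : ℝ := 2 / (G * (t + 1 + offset G l L))

variable {G L : ℝ}

theorem offset_pos (hG : 0 < G) (hGl : G ≤ l) (hL : 1 ≤ L) : 0 < offset G l L := by
  have : 0 < l := hG.trans_le hGl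
  unfold offset
  positivity

theorem sq_mul_offset (hG : 0 < G) : G ^ 2 * offset G l L = 400 * l * L := by
  unfold offset
  field_simp

theorem rate_pos (hG : 0 < G) (hGl : G ≤ l) (hL : 1 ≤ L) (t : ℕ) : 0 < rate G l L t := by
  have := offset_pos hG hGl hL
  unfold rate
  positivity

theorem le_mul_offset (hG : 0 < G) (hGl : G ≤ l) (hL : 1 ≤ L) : 400 * L ≤ G * offset G l L := by
  refine le_of_mul_le_mul_left ?_ hG
  have h1 := sq_mul_offset (l := l) (L := L) hG
  have h2 := mul_le_mul_of_nonneg_right hGl (by linarith : 0 ≤ L)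
  linarith

theorem rate_le (hG : 0 < G) (hGl : G ≤ l) (hL : 1 ≤ L) (t : ℕ) : rate G l L t ≤ 1 / 200 := by
  have h0 := offset_pos hG hGl hL
  have h2 := le_mul_offset hG hGl hL
  have h3 : (0 : ℝ) ≤ G * (t + 1) := by positivity
  unfold rate
  rw [div_le_div_iff₀ (by positivity) (by norm_num)]
  linarith

end Recursion

/-! ### The two exponential supermartingales and the numerical levels. -/

section Bounds

variable {n k m : ℕ} {V : Matrix (Fin n) (Fin k) ℝ} {Z : Matrix (Fin n) (Fin m) ℝ} {μ ν l : ℝ}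
  {D : Measure (EuclideanSpace ℝ (Fin n))} {Ω : Type*} [MeasurableSpace Ω] {P : Measure Ω}
  [IsProbabilityMeasure P] {y : ℕ → Ω → EuclideanSpace ℝ (Fin n)} {G L : ℝ}

/-- The potential ever exceeds `2` only with small probability. -/
theorem measure_exit_le (hD : ∀ᵐ x ∂D, ‖x‖ = 1) (h : IsSplitting (covariance D) V Z μ ν l)
    (hν : ν ≤ l) (hμν : μ - ν = G) (hG : 0 < G) (hGl : G ≤ l) (hL : 1 ≤ L)
    (hy : ∀ t, Measurable (y t)) (hlaw : ∀ t, P.map (y t) = D) (hind : iIndepFun y P)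
    {S₀ : Matrix (Fin m) (Fin k) ℝ} (hS₀ : frobSq S₀ ≤ 1) :
    P {ω | ∃ t, 2 < frobSq (stateAt (ojaStep V Z (rate G l L)) S₀ (fun i => y i ω) t) ∧
      ∀ i < t, frobSq (stateAt (ojaStep V Z (rate G l L)) S₀ (fun i => y i ω) i) ≤ 2} ≤
    ENNReal.ofReal (Real.exp (-3 * L + 1)) := by
  set t₀ := offset G l L with ht₀
  have ht₀pos : 0 < t₀ := offset_pos hG hGl hL
  have hlpos : 0 < l := hG.trans_le hGl
  have hG2 : G ^ 2 * t₀ = 400 * l * L := sq_mul_offset hG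
  have hGt : 400 * L ≤ G * t₀ := le_mul_offset hG hGl hL
  have hT : ∀ T : ℕ, P {ω | ∃ t ≤ T,
      2 < frobSq (stateAt (ojaStep V Z (rate G l L)) S₀ (fun i => y i ω) t) ∧
      ∀ i < t, frobSq (stateAt (ojaStep V Z (rate G l L)) S₀ (fun i => y i ω) i) ≤ 2} ≤
      ENNReal.ofReal (Real.exp (-3 * L + 1)) := by
    intro T
    -- With `θ = 3L` the level `2` costs `6L` and the start at most `3L`. The last term of the
    -- offset is the noise still to come, at most `336/400` in total.
    have hmain := measure_exceed_le hD h hlpos.le hν hy hlaw hind (rate_pos hG hGl hL)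
      (rate_le hG hGl hL) S₀ Set.univ (fun _ => 2) (fun _ => 3 * L)
      (fun t => -(6 * L) + 336 * l * L / G ^ 2 / (t + t₀)) T (fun _ _ => by positivity) ?_ ?_ ?_
    · simp only [Set.mem_univ, true_and] at hmain
      refine hmain.trans (ENNReal.ofReal_le_ofReal (Real.exp_le_exp.2 ?_))
      have h1 : 336 * l * L / G ^ 2 / ((0 : ℕ) + t₀) ≤ 1 := by
        rw [Nat.cast_zero, zero_add, div_div, hG2, div_le_one (by positivity)]
        have : 0 < l * L := by positivity
        linarith
      have h2 := mul_le_mul_of_nonneg_left hS₀ (by positivity : 0 ≤ 3 * L)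
      linarith
    · intro t _
      have h1 : (0 : ℝ) ≤ G * (t + 1) := by positivity
      rw [rate, ← ht₀, mul_div_assoc', div_le_div_iff₀ (by positivity) (by norm_num)]
      linarith
    · intro t _ X hX0 _
      rw [rate, ← ht₀, hμν]
      have hτ : 0 < (t : ℝ) + 1 + t₀ := by positivity
      have hτ' : 0 < (t : ℝ) + t₀ := by positivity
      push_cast
      set τ := (t : ℝ) + 1 + t₀ with hτdef
      have e1 : (t : ℝ) + t₀ = τ - 1 := by rw [hτdef]; ring
      rw [e1] at hτ' ⊢
      have h1 : 216 * l * L ≤ G ^ 2 * τ := by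
        have : 0 ≤ G ^ 2 * ((t : ℝ) + 1) := by positivity
        have h3 : 0 < l * L := by positivity
        rw [hτdef]
        linarith
      -- The variance term is absorbed by the drift, so the coefficient of `X` is at most `1`.
      have h2 : 72 * (3 * L) * (2 / (G * τ)) ^ 2 * l ≤ 2 * (2 / (G * τ)) * G := by
        have e2 : 72 * (3 * L) * (2 / (G * τ)) ^ 2 * l = 864 * l * L / (G ^ 2 * τ * τ) := by
          field_simp
          ring
        have e3 : 2 * (2 / (G * τ)) * G = 4 / τ := by
          field_simp
          ring
        rw [e2, e3, div_le_div_iff₀ (by positivity) (by positivity)]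
        have := mul_le_mul_of_nonneg_right h1 hτ.le
        linarith
      -- Telescoping of the accumulated noise.
      have h3 : 1 / τ ^ 2 + 1 / τ ≤ 1 / (τ - 1) := by
        rw [div_add_div _ _ (by positivity) (by positivity),
          div_le_div_iff₀ (by positivity) (by positivity)]
        nlinarith
      have h4 : 3 * L * (28 * (2 / (G * τ)) ^ 2 * l) = 336 * l * L / G ^ 2 * (1 / τ ^ 2) := by
        field_simp
        ring
      have h5 := mul_le_mul_of_nonneg_left h3 (by positivity : 0 ≤ 336 * l * L / G ^ 2)
      have h6 := mul_le_mul_of_nonneg_left (mul_le_mul_of_nonneg_right h2 hX0)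
        (by positivity : 0 ≤ 3 * L)
      rw [div_eq_mul_one_div _ τ, div_eq_mul_one_div _ (τ - 1)]
      linarith
    · intro t _ _
      have : 0 ≤ 336 * l * L / G ^ 2 / (t + t₀) := by positivity
      linarith
  have hunion : {ω | ∃ t, 2 < frobSq (stateAt (ojaStep V Z (rate G l L)) S₀ (fun i => y i ω) t) ∧
      ∀ i < t, frobSq (stateAt (ojaStep V Z (rate G l L)) S₀ (fun i => y i ω) i) ≤ 2} =
      ⋃ T : ℕ, {ω | ∃ t ≤ T,
        2 < frobSq (stateAt (ojaStep V Z (rate G l L)) S₀ (fun i => y i ω) t) ∧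
        ∀ i < t, frobSq (stateAt (ojaStep V Z (rate G l L)) S₀ (fun i => y i ω) i) ≤ 2} := by
    ext ω
    simp only [Set.mem_ofPred_eq, Set.mem_iUnion]
    exact ⟨fun ⟨t, ht⟩ => ⟨t, t, le_rfl, ht⟩, fun ⟨_, t, _, ht⟩ => ⟨t, ht⟩⟩
  rw [hunion, Monotone.measure_iUnion]
  · exact iSup_le hT
  · rintro T T' hTT ω ⟨t, ht, h'⟩
    exact ⟨t, ht.trans hTT, h'⟩

/-- The weight of the potential at time `t` in the exponential supermartingale with horizon
`T`. -/
noncomputable def weight (G l L : ℝ) (T t : ℕ) : ℝ :=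
  1 / 144 * (G ^ 2 / l) * (t + offset G l L) ^ 2 / (T + offset G l L)

/-- The weighted potential exceeds `ρ` within the set `I` of times up to `T`, before the potential
exceeds `2`, only with small probability. -/
theorem measure_weighted_exceed_le (hD : ∀ᵐ x ∂D, ‖x‖ = 1)
    (h : IsSplitting (covariance D) V Z μ ν l)
    (hν : ν ≤ l) (hμν : μ - ν = G) (hG : 0 < G) (hGl : G ≤ l) (hL : 1 ≤ L)
    (hy : ∀ t, Measurable (y t)) (hlaw : ∀ t, P.map (y t) = D) (hind : iIndepFun y P)
    {S₀ : Matrix (Fin m) (Fin k) ℝ} (hS₀ : frobSq S₀ ≤ 1) (T : ℕ) (I : Set ℕ) (r : ℕ → ℝ) (ρ : ℝ)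
    (hr : ∀ t ≤ T, t ∈ I → ρ ≤ weight G l L T t * r t) :
    P {ω | ∃ t ≤ T, t ∈ I ∧
      r t < frobSq (stateAt (ojaStep V Z (rate G l L)) S₀ (fun i => y i ω) t) ∧
      ∀ i < t, frobSq (stateAt (ojaStep V Z (rate G l L)) S₀ (fun i => y i ω) i) ≤ 2} ≤
    ENNReal.ofReal (Real.exp (3 * L + 1 - ρ)) := by
  set t₀ := offset G l L with ht₀
  have ht₀pos : 0 < t₀ := offset_pos hG hGl hL
  have hlpos : 0 < l := hG.trans_le hGl
  have hG2 : G ^ 2 * t₀ = 400 * l * L := sq_mul_offset hG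
  have hTpos : 0 < (T : ℝ) + t₀ := by positivity
  -- Each step adds noise at most `1 / (T + t₀)`, which the offset releases; the total is at most
  -- `1`. The initial weight is at most `400/144 L ≤ 3L`.
  have hmain := measure_exceed_le hD h hlpos.le hν hy hlaw hind (rate_pos hG hGl hL)
    (rate_le hG hGl hL) S₀ I r (weight G l L T)
    (fun t => ((T : ℝ) - t) / (T + t₀) - ρ) T
    (fun _ _ => by unfold weight; positivity) ?_ ?_ ?_
  · refine hmain.trans (ENNReal.ofReal_le_ofReal (Real.exp_le_exp.2 ?_))
    have h1 : ((T : ℝ) - (0 : ℕ)) / (T + t₀) ≤ 1 := by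
      rw [div_le_one hTpos, Nat.cast_zero]
      linarith
    have h2 : weight G l L T 0 ≤ 3 * L := by
      rw [weight, ← ht₀, Nat.cast_zero, zero_add, div_le_iff₀ hTpos]
      have e1 : 1 / 144 * (G ^ 2 / l) * t₀ ^ 2 = 400 / 144 * L * t₀ := by
        field_simp
        linear_combination hG2
      rw [e1]
      have h3 : 0 ≤ L * T := by positivity
      have h4 : 0 ≤ L * t₀ := by positivity
      linarith
    have h3 : weight G l L T 0 * frobSq S₀ ≤ 3 * L * 1 :=
      mul_le_mul h2 hS₀ (frobSq_nonneg _) (by positivity)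
    linarith
  · intro t ht
    have hle : (t : ℝ) + 1 ≤ T := by exact_mod_cast ht
    rw [rate, weight, ← ht₀]
    push_cast
    set τ := (t : ℝ) + 1 + t₀ with hτdef
    have hτ : 0 < τ := by positivity
    have e1 : 1 / 144 * (G ^ 2 / l) * τ ^ 2 / (T + t₀) * (2 / (G * τ)) =
        1 / 72 * ((G * τ) / (l * (T + t₀))) := by
      field_simp
      ring
    have h1 : (G * τ) / (l * (T + t₀)) ≤ 1 := by
      rw [div_le_one (by positivity)]
      exact mul_le_mul hGl (by linarith) hτ.le hlpos.le
    rw [e1]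
    linarith
  · intro t ht X hX0 _
    have hle : (t : ℝ) + 1 ≤ T := by exact_mod_cast ht
    rw [rate, weight, weight, ← ht₀, hμν]
    push_cast
    set τ := (t : ℝ) + 1 + t₀ with hτdef
    have hτ : 0 < τ := by positivity
    have hτT : τ ≤ T + t₀ := by linarith
    have e1 : (t : ℝ) + t₀ = τ - 1 := by rw [hτdef]; ring
    rw [e1]
    set R := (T : ℝ) + t₀ with hRdef
    have e2 : 1 / 144 * (G ^ 2 / l) * τ ^ 2 / R * (28 * (2 / (G * τ)) ^ 2 * l) =
        7 / 9 * (1 / R) := by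
      field_simp
      ring
    have e3 : 1 / 144 * (G ^ 2 / l) * τ ^ 2 / R * (1 - 2 * (2 / (G * τ)) * G +
        72 * (1 / 144 * (G ^ 2 / l) * τ ^ 2 / R) * (2 / (G * τ)) ^ 2 * l) =
        1 / 144 * (G ^ 2 / l) / R * (τ ^ 2 - 4 * τ + 2 * τ * (τ / R)) := by
      field_simp
      ring
    have h1 : τ / R ≤ 1 := (div_le_one hTpos).2 hτT
    -- The drift contributes `-4τ`, and the factor `1/144` in the weight makes the variance term at
    -- most `2τ`. The remaining contraction `1 - 2/τ` is what a weight quadratic in time can grow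
    -- against.
    have h2 : τ ^ 2 - 4 * τ + 2 * τ * (τ / R) ≤ (τ - 1) ^ 2 := by
      have := mul_le_mul_of_nonneg_left h1 (by positivity : 0 ≤ 2 * τ)
      linarith
    have h3 := mul_le_mul_of_nonneg_right (mul_le_mul_of_nonneg_left h2
      (by positivity : 0 ≤ 1 / 144 * (G ^ 2 / l) / R)) hX0
    have e4 : 1 / 144 * (G ^ 2 / l) / R * (τ - 1) ^ 2 =
        1 / 144 * (G ^ 2 / l) * (τ - 1) ^ 2 / R := by ring
    have e5 : ((T : ℝ) - t) / R = ((T : ℝ) - (t + 1)) / R + 1 / R := by ring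
    have h4 : 0 < 1 / R := by positivity
    rw [mul_add, ← mul_assoc, e3, e2, e5, ← e4]
    linarith
  · intro t ht hI
    have hle : (t : ℝ) ≤ T := by exact_mod_cast ht
    have h1 : 0 ≤ ((T : ℝ) - t) / (T + t₀) := div_nonneg (by linarith) hTpos.le
    linarith [hr t ht hI]

theorem weight_last_mul (hG : 0 < G) (hGl : G ≤ l) (hL : 1 ≤ L) {T : ℕ} (hT : 1 ≤ T) :
    13 * L ≤ weight G l L T T * (2000 * l * L / (G ^ 2 * T)) := by
  have ht₀ : 0 < offset G l L := offset_pos hG hGl hL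
  have hl : 0 < l := hG.trans_le hGl
  have hT' : (0 : ℝ) < T := by exact_mod_cast hT
  have e1 : weight G l L T T * (2000 * l * L / (G ^ 2 * T)) =
      2000 / 144 * L * ((T + offset G l L) / T) := by
    unfold weight
    field_simp
  have h1 : 1 ≤ (T + offset G l L) / T := by
    rw [le_div_iff₀ hT']
    linarith
  rw [e1]
  have := mul_le_mul_of_nonneg_left h1 (by positivity : 0 ≤ 2000 / 144 * L)
  linarith

/-- Using the weight before its horizon, but not before half of it, costs at most a factor `2`:
`30000 / 144 / 2 > 104`. -/
theorem weight_epoch_mul (hG : 0 < G) (hGl : G ≤ l) (hL : 1 ≤ L) {T t : ℕ} (ht : 1 ≤ t)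
    (hT : T ≤ 2 * t) {Q : ℝ} (hQ : 0 ≤ Q) :
    104 * Q ≤ weight G l L T t * (30000 * l * Q / (G ^ 2 * t)) := by
  have ht₀ : 0 < offset G l L := offset_pos hG hGl hL
  have hl : 0 < l := hG.trans_le hGl
  have ht' : (0 : ℝ) < t := by exact_mod_cast ht
  have hT' : (T : ℝ) ≤ 2 * t := by exact_mod_cast hT
  have hT0 : (0 : ℝ) ≤ T := by positivity
  have e1 : weight G l L T t * (30000 * l * Q / (G ^ 2 * t)) =
      30000 / 144 * Q * ((t + offset G l L) ^ 2 / ((T + offset G l L) * t)) := by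
    unfold weight
    field_simp
  have h1 : 1 / 2 ≤ (t + offset G l L) ^ 2 / ((T + offset G l L) * t) := by
    rw [div_le_div_iff₀ (by norm_num) (by positivity)]
    nlinarith
  rw [e1]
  have := mul_le_mul_of_nonneg_left h1 (by positivity : 0 ≤ 30000 / 144 * Q)
  linarith

/-- At `t = 1` the iterated logarithm is negative; with this bound `L + 2 log log 2 ≥ L - 4/5` stays
positive for `L ≥ 1`. -/
theorem neg_two_fifths_le_log_log_two : -(2 / 5) ≤ Real.log (Real.log 2) := by
  rw [Real.le_log_iff_exp_le (Real.log_pos (by norm_num))]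
  have h1 : Real.exp (-(2 / 5)) ≤ 1 / (1 + 2 / 5 + (2 / 5) ^ 2 / 2) := by
    rw [Real.exp_neg, ← one_div]
    exact one_div_le_one_div_of_le (by norm_num)
      (Real.quadratic_le_exp_of_nonneg (by norm_num))
  have h2 := Real.log_two_gt_d9
  norm_num at h1
  linarith

theorem epoch_level_le (hL : 1 ≤ L) {j t : ℕ} (ht : 2 ^ j ≤ t) :
    20 * L + 2 * Real.log (j + 1) - 2 ≤ 104 * (L + 2 * Real.log (Real.log (t + 1))) ∧
      0 ≤ L + 2 * Real.log (Real.log (t + 1)) := by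
  have hl2 : 0 < Real.log 2 := Real.log_pos (by norm_num)
  -- The maximum covers `j = 0`, where `log j` would be useless, and still dominates `(j + 1) / 2`.
  set M : ℝ := max 1 j with hM
  have hM1 : 1 ≤ M := le_max_left _ _
  have hMj : ((j : ℝ) + 1) / 2 ≤ M := by
    have := le_max_right 1 (j : ℝ)
    linarith
  have ht' : (2 : ℝ) ^ j ≤ t := by exact_mod_cast ht
  have hone : (1 : ℝ) ≤ 2 ^ j := one_le_pow₀ (by norm_num)
  have h1 : M * Real.log 2 ≤ Real.log (t + 1) := by
    rcases max_choice 1 (j : ℝ) with h | h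
    · rw [hM, h, one_mul]
      exact Real.log_le_log (by norm_num) (by linarith)
    · rw [hM, h, ← Real.log_pow]
      exact Real.log_le_log (by positivity) (by linarith)
  have h2 : Real.log M + Real.log (Real.log 2) ≤ Real.log (Real.log (t + 1)) := by
    rw [← Real.log_mul (by positivity) hl2.ne']
    exact Real.log_le_log (by positivity) h1
  have h3 := neg_two_fifths_le_log_log_two
  have h4 : 0 ≤ Real.log M := Real.log_nonneg hM1
  have h5 : Real.log (j + 1) - Real.log 2 ≤ Real.log M := by
    rw [← Real.log_div (by positivity) (by norm_num)]
    exact Real.log_le_log (by positivity) hMj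
  have h6 := Real.log_two_lt_d9
  constructor <;> linarith

theorem sum_inv_sq_le_two (N : ℕ) : ∑ j ∈ Finset.range N, 1 / ((j : ℝ) + 1) ^ 2 ≤ 2 := by
  -- The subtracted term makes the induction telescope.
  have h : ∑ j ∈ Finset.range (N + 1), 1 / ((j : ℝ) + 1) ^ 2 ≤ 2 - 1 / ((N : ℝ) + 1) := by
    induction N with
    | zero => norm_num
    | succ N ih =>
      rw [Finset.sum_range_succ]
      push_cast
      have h1 : 1 / ((N : ℝ) + 1 + 1) ^ 2 + 1 / ((N : ℝ) + 1 + 1) ≤ 1 / ((N : ℝ) + 1) := by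
        rw [div_add_div _ _ (by positivity) (by positivity),
          div_le_div_iff₀ (by positivity) (by positivity)]
        nlinarith [(by positivity : (0 : ℝ) ≤ N)]
      linarith
  have h1 : (0 : ℝ) ≤ 1 / ((N : ℝ) + 1) := by positivity
  have h2 : (0 : ℝ) ≤ 1 / ((N : ℝ) + 1) ^ 2 := by positivity
  rw [Finset.sum_range_succ] at h
  linarith

end Bounds

/-! ### Union bounds and the passage to general samples. -/

section Final

variable {n k m : ℕ} {V : Matrix (Fin n) (Fin k) ℝ} {Z : Matrix (Fin n) (Fin m) ℝ} {μ ν l : ℝ}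
  {D : Measure (EuclideanSpace ℝ (Fin n))} {Ω : Type*} [MeasurableSpace Ω] {P : Measure Ω}
  [IsProbabilityMeasure P] {y : ℕ → Ω → EuclideanSpace ℝ (Fin n)} {G L : ℝ}

theorem exp_neg_one_lt_half : Real.exp (-1) < 1 / 2 := by
  have := Real.exp_neg_one_lt_d9
  linarith

theorem exp_neg_two_lt_quarter : Real.exp (-2) < 1 / 4 := by
  have h1 := exp_neg_one_lt_half
  have h2 : Real.exp (-2) = Real.exp (-1) * Real.exp (-1) := by
    rw [← Real.exp_add]
    norm_num
  nlinarith [Real.exp_pos (-1)]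

theorem exp_exit_lt (hL : 1 ≤ L) : Real.exp (-3 * L + 1) < Real.exp (-L) / 2 := by
  calc Real.exp (-3 * L + 1) ≤ Real.exp (-L + -1) := Real.exp_le_exp.2 (by linarith)
    _ = Real.exp (-L) * Real.exp (-1) := Real.exp_add _ _
    _ < Real.exp (-L) * (1 / 2) := mul_lt_mul_of_pos_left exp_neg_one_lt_half (Real.exp_pos _)
    _ = _ := by ring

theorem ofReal_add_lt {a b d : ℝ} (ha : 0 ≤ a) (hb : 0 ≤ b) (had : a < d / 2) (hbd : b ≤ d / 2) :
    ENNReal.ofReal a + ENNReal.ofReal b < ENNReal.ofReal d := by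
  rw [← ENNReal.ofReal_add ha hb]
  exact (ENNReal.ofReal_lt_ofReal_iff (by linarith)).2 (by linarith)

theorem exp_epoch_le (hL : 1 ≤ L) (j : ℕ) :
    Real.exp (3 * L + 1 - (20 * L + 2 * Real.log (j + 1) - 2)) ≤
      Real.exp (-L) / 4 * (1 / ((j : ℝ) + 1) ^ 2) := by
  have hj : (0 : ℝ) < j + 1 := by positivity
  have h1 : Real.exp (-(2 * Real.log (j + 1))) = 1 / ((j : ℝ) + 1) ^ 2 := by
    rw [Real.exp_neg, one_div, two_mul, Real.exp_add, Real.exp_log hj, sq]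
  calc Real.exp (3 * L + 1 - (20 * L + 2 * Real.log (j + 1) - 2))
      ≤ Real.exp (-L + -2 + -(2 * Real.log (j + 1))) := Real.exp_le_exp.2 (by linarith)
    _ = Real.exp (-L) * Real.exp (-2) * (1 / ((j : ℝ) + 1) ^ 2) := by
        rw [Real.exp_add, Real.exp_add, h1]
    _ ≤ Real.exp (-L) * (1 / 4) * (1 / ((j : ℝ) + 1) ^ 2) := by
        gcongr
        exact exp_neg_two_lt_quarter.le
    _ = _ := by ring

/-- Both convergence bounds, for samples that are measurable and of norm one everywhere. -/
theorem convergence_of_measurable (hD : ∀ᵐ x ∂D, ‖x‖ = 1)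
    (h : IsSplitting (covariance D) V Z μ ν l)
    (hν : ν ≤ l) (hμν : μ - ν = G) (hG : 0 < G) (hGl : G ≤ l) (hL : 1 ≤ L)
    {W₀ : Matrix (Fin n) (Fin k) ℝ} (hW₀ : PotentialLE V Z W₀ 1)
    (hy : ∀ t, Measurable (y t)) (hlaw : ∀ t, P.map (y t) = D) (hind : iIndepFun y P)
    (hy1 : ∀ t ω, ‖y t ω‖ = 1) :
    (∀ T : ℕ, 1 ≤ T →
      P {ω | ¬ PotentialLE V Z (oja (rate G l L) (fun s => y s ω) W₀ T)
        (2000 * l * L / (G ^ 2 * T))} < ENNReal.ofReal (Real.exp (-L))) ∧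
    P {ω | ∃ t : ℕ, 1 ≤ t ∧ ¬ PotentialLE V Z (oja (rate G l L) (fun s => y s ω) W₀ t)
      (30000 * l * (L + 2 * Real.log (Real.log (t + 1))) / (G ^ 2 * t))} <
      ENNReal.ofReal (Real.exp (-L)) := by
  set S₀ := Zᵀ * W₀ * (Vᵀ * W₀)⁻¹ with hS₀def
  have hS₀ : frobSq S₀ ≤ 1 := by
    rw [hS₀def, ← potential_eq_frobSq]
    exact hW₀.2
  have hexceed := fun (ω : Ω) (t : ℕ) (r : ℝ)
      (hnot : ¬ PotentialLE V Z (oja (rate G l L) (fun s => y s ω) W₀ t) r) =>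
    exceed_of_not_potentialLE h (rate_pos hG hGl hL) (rate_le hG hGl hL) (fun t => hy1 t ω)
      hW₀.1 hS₀def hnot
  have hexit := measure_exit_le hD h hν hμν hG hGl hL hy hlaw hind hS₀
  have hweighted := measure_weighted_exceed_le hD h hν hμν hG hGl hL hy hlaw hind hS₀
  refine ⟨fun T hT => ?_, ?_⟩
  -- `ρ = 13L` leaves `exp (1 - 10L)`, below `δ/2`; the exit event takes the other half.
  · have h1 := hweighted T {T} (fun t => 2000 * l * L / (G ^ 2 * t)) (13 * L) (by
      rintro t - rfl
      exact weight_last_mul hG hGl hL hT)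
    refine lt_of_le_of_lt ((measure_mono ?_).trans ((measure_union_le _ _).trans
      (add_le_add hexit h1))) (ofReal_add_lt (Real.exp_nonneg _) (Real.exp_nonneg _)
        (exp_exit_lt hL) ?_)
    · intro ω hω
      rcases hexceed ω T _ hω with h2 | h2
      · exact Or.inl h2
      · exact Or.inr ⟨T, le_rfl, rfl, h2⟩
    · exact (Real.exp_le_exp.2 (by linarith)).trans (exp_exit_lt hL).le
  · let r : ℕ → ℝ := fun t =>
      30000 * l * (L + 2 * Real.log (Real.log (t + 1))) / (G ^ 2 * t)
    -- Epoch `j` consists of the times from `2^j` to `2^(j+1)`. The term `2 log (j + 1)` in `ρ`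
    -- makes the failure probabilities summable.
    have h1 := fun j : ℕ => hweighted (2 ^ (j + 1)) {t | 2 ^ j ≤ t} r
      (20 * L + 2 * Real.log (j + 1) - 2) (by
        intro t ht hI
        obtain ⟨h2, h3⟩ := epoch_level_le hL hI
        refine h2.trans (weight_epoch_mul hG hGl hL ?_ ?_ h3)
        · exact Nat.one_le_two_pow.trans hI
        · rw [pow_succ, mul_comm]
          exact Nat.mul_le_mul_left 2 hI)
    have hsum : ∑' j : ℕ, ENNReal.ofReal
        (Real.exp (3 * L + 1 - (20 * L + 2 * Real.log (j + 1) - 2))) ≤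
        ENNReal.ofReal (Real.exp (-L) / 2) := by
      refine ENNReal.tsum_le_of_sum_range_le fun N => ?_
      rw [← ENNReal.ofReal_sum_of_nonneg fun _ _ => Real.exp_nonneg _]
      refine ENNReal.ofReal_le_ofReal ((Finset.sum_le_sum fun j _ => exp_epoch_le hL j).trans ?_)
      rw [← Finset.mul_sum]
      have h2 := mul_le_mul_of_nonneg_left (sum_inv_sq_le_two N)
        (by positivity : 0 ≤ Real.exp (-L) / 4)
      linarith
    refine lt_of_le_of_lt ((measure_mono ?_).trans ((measure_union_le _ _).trans
      (add_le_add hexit ((measure_iUnion_le _).trans ((ENNReal.tsum_le_tsum h1).trans hsum)))))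
      (ofReal_add_lt (Real.exp_nonneg _) (by positivity) (exp_exit_lt hL) le_rfl)
    rintro ω ⟨t, ht, hω⟩
    rcases hexceed ω t _ hω with h2 | h2
    · exact Or.inl h2
    · refine Or.inr (Set.mem_iUnion.2 ⟨Nat.log 2 t, t, ?_, ?_, h2⟩)
      · exact (Nat.lt_pow_succ_log_self (by norm_num) t).le
      · exact Nat.pow_log_le_self 2 (by omega)

end Final

/-- `HasLaw` only gives almost everywhere measurability and almost surely unit norm, while the
recursion argument uses both everywhere. Exceptional values are replaced by a basis vector. -/
theorem exists_measurable_unit_modification {n : ℕ} (hn : 0 < n)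
    {D : Measure (EuclideanSpace ℝ (Fin n))} {Ω : Type*} [MeasurableSpace Ω] {P : Measure Ω}
    (hD : ∀ᵐ x ∂D, ‖x‖ = 1)
    {x : ℕ → Ω → EuclideanSpace ℝ (Fin n)} (hx : ∀ t, HasLaw (x t) D P) :
    ∃ y : ℕ → Ω → EuclideanSpace ℝ (Fin n), (∀ t, Measurable (y t)) ∧ (∀ t ω, ‖y t ω‖ = 1) ∧
      ∀ t, x t =ᵐ[P] y t := by
  have hnorm : ∀ t, ∀ᵐ ω ∂P, ‖x t ω‖ = 1 := fun t =>
    ae_of_ae_map (hx t).aemeasurable ((hx t).map_eq.symm ▸ hD)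
  let z : ℕ → Ω → EuclideanSpace ℝ (Fin n) := fun t => (hx t).aemeasurable.mk
  have hz : ∀ t, Measurable (z t) := fun t => (hx t).aemeasurable.measurable_mk
  classical
  refine ⟨fun t ω => if ‖z t ω‖ = 1 then z t ω else EuclideanSpace.single ⟨0, hn⟩ 1,
    fun t => ?_, fun t ω => ?_, fun t => ?_⟩
  · exact Measurable.ite (measurableSet_eq_fun (hz t).norm measurable_const) (hz t)
      measurable_const
  · beta_reduce
    split_ifs with h
    · exact h
    · simp
  · filter_upwards [hnorm t, (hx t).aemeasurable.ae_eq_mk] with ω h1 h2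
    have h3 : x t ω = z t ω := h2
    rw [← h3, if_pos h1]

end StreamingPCA

theorem mainTheorem2 {n k : ℕ} (hk : 1 ≤ k) (hkn : k < n)
    (D : Measure (EuclideanSpace ℝ (Fin n))) [IsProbabilityMeasure D]
    (hD : ∀ᵐ x ∂D, ‖x‖ = 1)
    (hgap : 0 < StreamingPCA.gap D k hkn)
    (δ : ℝ) (hδ : 0 < δ) (hδ' : δ ≤ Real.exp (-1)) :
    ∃ η : ℕ → ℝ, (∀ t, 0 < η t) ∧
      ∀ (V : Matrix (Fin n) (Fin k) ℝ) (Z : Matrix (Fin n) (Fin (n - k)) ℝ)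
        (W₀ : Matrix (Fin n) (Fin k) ℝ),
        StreamingPCA.IsOrthonormalBasisMatrix V (StreamingPCA.topEigenspace D k) →
        StreamingPCA.IsOrthonormalBasisMatrix Z (StreamingPCA.bottomEigenspace D k) →
        StreamingPCA.PotentialLE V Z W₀ 1 →
        ∀ (Ω : Type*) [MeasurableSpace Ω] (P : Measure Ω) [IsProbabilityMeasure P]
          (x : ℕ → Ω → EuclideanSpace ℝ (Fin n)),
          (∀ t, HasLaw (x t) D P) → iIndepFun x P →
          (∀ T : ℕ, 1 ≤ T →
            P {ω | ¬ StreamingPCA.PotentialLE V Z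
                (StreamingPCA.oja η (fun s => x s ω) W₀ T)
                (2000 * StreamingPCA.topSum D k * Real.log (1 / δ) /
                  (StreamingPCA.gap D k hkn ^ 2 * T))} < ENNReal.ofReal δ) ∧
          P {ω | ∃ t : ℕ, 1 ≤ t ∧ ¬ StreamingPCA.PotentialLE V Z
                (StreamingPCA.oja η (fun s => x s ω) W₀ t)
                (30000 * StreamingPCA.topSum D k *
                  (Real.log (1 / δ) + 2 * Real.log (Real.log (t + 1))) /
                  (StreamingPCA.gap D k hkn ^ 2 * t))} < ENNReal.ofReal δ := by
  have hpos := StreamingPCA.eigenvalue_nonneg hD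
  have hlam : StreamingPCA.eigenvalue D ⟨k - 1, by omega⟩ ≤ StreamingPCA.topSum D k :=
    Finset.single_le_sum (f := StreamingPCA.eigenvalue D) (fun i _ => hpos i)
      (Finset.mem_filter.2 ⟨Finset.mem_univ _, by
        show k - 1 < k
        omega⟩)
  have hkpos := hpos ⟨k, hkn⟩
  have hGl : StreamingPCA.gap D k hkn ≤ StreamingPCA.topSum D k := by
    unfold StreamingPCA.gap
    linarith
  have hν : StreamingPCA.eigenvalue D ⟨k, hkn⟩ ≤ StreamingPCA.topSum D k :=
    (StreamingPCA.eigenvalue_antitone D (by simp [Fin.le_def])).trans hlam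
  have hL : 1 ≤ Real.log (1 / δ) := by
    rw [one_div, Real.log_inv]
    have := Real.log_le_log hδ hδ'
    rw [Real.log_exp] at this
    linarith
  have hexp : Real.exp (-Real.log (1 / δ)) = δ := by
    rw [one_div, Real.log_inv, neg_neg, Real.exp_log hδ]
  refine ⟨StreamingPCA.rate (StreamingPCA.gap D k hkn) (StreamingPCA.topSum D k)
    (Real.log (1 / δ)), StreamingPCA.rate_pos hgap hGl hL, ?_⟩
  intro V Z W₀ hV hZ hW₀ Ω _ P _ x hx hind
  have hsplit := StreamingPCA.isSplitting_covariance hk hkn hgap hpos hV hZ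
  obtain ⟨y, hy, hy1, hxy⟩ :=
    StreamingPCA.exists_measurable_unit_modification (by omega) hD hx
  have hlaw : ∀ t, P.map (y t) = D := fun t =>
    (Measure.map_congr (hxy t)).symm.trans (hx t).map_eq
  have hall : ∀ᵐ ω ∂P, ∀ t, x t ω = y t ω := ae_all_iff.2 hxy
  obtain ⟨h1, h2⟩ := StreamingPCA.convergence_of_measurable hD hsplit hν
    (G := StreamingPCA.gap D k hkn) rfl hgap hGl hL hW₀ hy hlaw ((iIndepFun_congr hxy).1 hind) hy1
  rw [hexp] at h1 h2
  refine ⟨fun T hT => lt_of_le_of_lt (measure_mono_ae ?_) (h1 T hT),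
    lt_of_le_of_lt (measure_mono_ae ?_) h2⟩
  · filter_upwards [hall] with ω hω h3
    have e : (fun s => x s ω) = fun s => y s ω := funext hω
    have h4 : ¬ StreamingPCA.PotentialLE V Z (StreamingPCA.oja _ (fun s => x s ω) W₀ T) _ := h3
    rw [e] at h4
    exact h4
  · filter_upwards [hall] with ω hω h3
    have e : (fun s => x s ω) = fun s => y s ω := funext hω
    obtain ⟨t, ht, h4⟩ := h3
    rw [e] at h4
    exact ⟨t, ht, h4⟩
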